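/- Call a compact set $U\subset\mathbb{R}^3$ \emph{regular} if its boundary surface $\partial U$ has finite area and has an outward unit normal at almost every point with respect to the surface measure $dS$ (two-dimensional Hausdorff measure normalized to be surface area). Here $U$ has the outward unit normal $n(\mathsf{x})$ at $\mathsf{x}\in\partial U$ if near $\mathsf{x}$ it is the sublevel set $\{\varphi\le 0\}$ of a $C^1$ function $\varphi$ with $\varphi(\mathsf{x})=0$ and $\nabla\varphi(\mathsf{x})\neq 0$, and then $n(\mathsf{x})=\nabla\varphi(\mathsf{x})/|\nabla\varphi(\mathsf{x})|$. Identify $(x,y,z)\in\mathbb{R}^3$ with the reduced quaternion $x+y\mathbf{i}+z\mathbf{j}$, and for $r=r_1+r_2\mathbf{i}+r_3\mathbf{j}$ and $F=F_1+F_2\mathbf{i}+F_3\mathbf{j}$ put $$r\times F=(r_2F_3-r_3F_2)+(r_3F_1-r_1F_3)\mathbf{i}+(r_1F_2-r_2F_1)\mathbf{j}.$$ Let $U\subset\mathbb{R}^3$ be regular, let $p$ be a real-valued pressure field that is constant on the whole surface $\partial U$, and let $\mathsf{x}_0\in\mathbb{R}^3$ be any point. Then $\mathsf{x}\mapsto p(\mathsf{x})\,\big((\mathsf{x}-\mathsf{x}_0)\times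 n(\mathsf{x})\big)$ is integrable over $\partial U$ with respect to $dS$, and the moment of the pressure about $\mathsf{x}_0$ vanishes: $$M_{\mathsf{x}_0}=-\int_{\partial U}p(\mathsf{x})\,\big((\mathsf{x}-\mathsf{x}_0)\times n(\mathsf{x})\big)\,dS(\mathsf{x})=0.$$ -/

import Mathlib

open MeasureTheory Filter
open scoped Topology Quaternion Gradient

/-- Points `(x, y, z)` of three-dimensional Euclidean space. -/
abbrev Space3 := EuclideanSpace ℝ (Fin 3)

/-- The identification of `(x, y, z) ∈ ℝ³` with the reduced quaternion `x + y i + z j`. -/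
def toReduced (a : Space3) : ℍ[ℝ] := ⟨a 0, a 1, a 2, 0⟩

/-- The cross product of reduced quaternions: for `r = r₁ + r₂ i + r₃ j` and
`F = F₁ + F₂ i + F₃ j`, the formal determinant with rows `(1, i, j)`, `(r₁, r₂, r₃)`
and `(F₁, F₂, F₃)`. The `k`-components play no role. -/
def reducedCross (r F : ℍ[ℝ]) : ℍ[ℝ] :=
  ⟨r.imI * F.imJ - r.imJ * F.imI, r.imJ * F.re - r.re * F.imJ, r.re * F.imI - r.imI * F.re, 0⟩

/-- `n` is the outward unit normal of `U` at `x`: near `x`, the set `U` is the sublevel set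
`{φ ≤ 0}` of a `C¹` function `φ` with `φ x = 0` and nonvanishing gradient at `x`, and `n` is
the normalized gradient of `φ` at `x`. -/
def IsOutwardUnitNormal (U : Set Space3) (x n : Space3) : Prop :=
  ∃ φ : Space3 → ℝ, ContDiffAt ℝ 1 φ x ∧ φ x = 0 ∧ ∇ φ x ≠ 0 ∧
    (∀ᶠ y in 𝓝 x, y ∈ U ↔ φ y ≤ 0) ∧ n = ‖∇ φ x‖⁻¹ • ∇ φ x

/-- The outward unit normal is unique where it exists. -/
theorem IsOutwardUnitNormal.unique {U : Set Space3} {x n m : Space3}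
    (hn : IsOutwardUnitNormal U x n) (hm : IsOutwardUnitNormal U x m) : n = m := by
  obtain ⟨f, hf, hf0, hfg, hfU, rfl⟩ := hn
  obtain ⟨g, hg, hg0, hgg, hgU, rfl⟩ := hm
  set a := ‖∇ f x‖⁻¹ • ∇ f x with ha
  set b := ‖∇ g x‖⁻¹ • ∇ g x with hb
  have hfp : 0 < ‖∇ f x‖ := norm_pos_iff.2 hfg
  have hgp : 0 < ‖∇ g x‖ := norm_pos_iff.2 hgg
  have ha1 : ‖a‖ = 1 := by
    rw [ha, norm_smul, norm_inv, norm_norm, inv_mul_cancel₀ hfp.ne']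
  have hb1 : ‖b‖ = 1 := by
    rw [hb, norm_smul, norm_inv, norm_norm, inv_mul_cancel₀ hgp.ne']
  by_contra hab
  have hlt : inner ℝ a b < 1 := (inner_lt_one_iff_real_of_norm_eq_one ha1 hb1).2 hab
  -- along the direction `b - a` the function `f` decreases and `g` increases
  have key : ∀ h : Space3 → ℝ, ContDiffAt ℝ 1 h x → h x = 0 →
      Tendsto (fun t : ℝ => t⁻¹ • h (x + t • (b - a))) (𝓝[>] 0)
        (𝓝 (inner ℝ (∇ h x) (b - a))) := by
    intro h hh h0
    have hd : HasFDerivAt h (InnerProductSpace.toDual ℝ Space3 (∇ h x)) x :=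
      (hh.differentiableAt one_ne_zero).hasGradientAt.hasFDerivAt
    have hl := (hd.hasLineDerivAt (b - a)).tendsto_slope_zero_right
    simpa [h0] using hl
  have hfa : ∇ f x = ‖∇ f x‖ • a := by rw [ha, smul_smul, mul_inv_cancel₀ hfp.ne', one_smul]
  have hgb : ∇ g x = ‖∇ g x‖ • b := by rw [hb, smul_smul, mul_inv_cancel₀ hgp.ne', one_smul]
  have hfneg : inner ℝ (∇ f x) (b - a) < 0 := by
    rw [hfa, real_inner_smul_left, inner_sub_right, real_inner_self_eq_norm_sq, ha1]
    exact mul_neg_of_pos_of_neg hfp (by linarith)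
  have hgpos : 0 < inner ℝ (∇ g x) (b - a) := by
    rw [hgb, real_inner_smul_left, inner_sub_right, real_inner_self_eq_norm_sq, hb1,
      real_inner_comm]
    exact mul_pos hgp (by linarith)
  have hc : Tendsto (fun t : ℝ => x + t • (b - a)) (𝓝[>] 0) (𝓝 x) := by
    have : Continuous fun t : ℝ => x + t • (b - a) := by fun_prop
    simpa using (this.tendsto 0).mono_left nhdsWithin_le_nhds
  have hev : ∀ᶠ t : ℝ in 𝓝[>] 0, False := by
    filter_upwards [(key f hf hf0).eventually (gt_mem_nhds hfneg),
      (key g hg hg0).eventually (lt_mem_nhds hgpos), hc.eventually hfU, hc.eventually hgU,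
      self_mem_nhdsWithin] with t h1 h2 h3 h4 ht
    have ht : 0 < t⁻¹ := inv_pos.2 ht
    simp only [smul_eq_mul] at h1 h2
    have h5 : f (x + t • (b - a)) < 0 := by
      by_contra hcon
      exact absurd h1 (not_lt.2 (mul_nonneg ht.le (not_lt.1 hcon)))
    have h6 : 0 < g (x + t • (b - a)) := pos_of_mul_pos_right h2 ht.le
    exact absurd (h4.1 (h3.2 h5.le)) (not_le.2 h6)
  exact hev.exists.elim fun _ h => h

open Classical in
/-- The outward unit normal of `U` at `x`, with value `0` at points where there is none. -/
noncomputable def outwardNormal (U : Set Space3) (x : Space3) : Space3 :=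
  if h : ∃ n, IsOutwardUnitNormal U x n then h.choose else 0

/-- The scalar surface measure `dS` on the boundary `∂U`: two-dimensional Hausdorff measure,
normalized so that it is surface area, restricted to the boundary. -/
noncomputable def surfaceMeasure (U : Set Space3) : Measure Space3 :=
  (Measure.euclideanHausdorffMeasure 2).restrict (frontier U)

/-- Regular sets: compact sets whose boundary has finite area and has an outward unit normal
at almost all of its points. -/
structure IsRegularDomain (U : Set Space3) : Prop where
  isCompact : IsCompact U
  area_lt_top : Measure.euclideanHausdorffMeasure 2 (frontier U) < ⊤
  ae_normal : ∀ᵐ x ∂surfaceMeasure U, ∃ n, IsOutwardUnitNormal U x n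

/-- The integrand `p(x) (r(x) × n(x))` of the moment, with `r(x) = x - x₀`. -/
noncomputable def momentDensity (U : Set Space3) (p : Space3 → ℝ) (x₀ x : Space3) : ℍ[ℝ] :=
  p x • reducedCross (toReduced (x - x₀)) (toReduced (outwardNormal U x))

/-- The moment about `x₀` that the pressure field `p` induces on the body `U`. -/
noncomputable def pressureMoment (U : Set Space3) (p : Space3 → ℝ) (x₀ : Space3) : ℍ[ℝ] :=
  -∫ x, momentDensity U p x₀ x ∂surfaceMeasure U

/-! The components of `(x - x₀) × n` are differences of products `(x - x₀)ᵢ nⱼ` with `i ≠ j`. By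
Gauss–Green, the integral of such a product over `∂U` is the integral over `U` of the `j`-th
derivative of `(x - x₀)ᵢ`, which is zero. A pressure constant on `∂U` factors out, and integrability
holds because everything is bounded on a boundary of finite area.

The work is the formula `∫_U ∂_w f = ∫_∂U f ⟨w, n⟩ dS` (`IsRegularDomain.gaussGreen`) for a boundary
that may have a singular set `E` of zero area.

Near a regular point and for a direction `v` with `⟨n, v⟩ > 0`, the set is a subgraph in coordinates
with `v` vertical. Integrating along vertical lines gives an integral of `f` over the base. It
equals the surface integral because the area factor of the graph is `1 / ⟨v, n⟩`
(`setIntegral_image_eq_setIntegral_areaFactor`, `areaFactor_mul_inner_normal`). Every direction is a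
combination of two such `v`, and a partition of unity treats all `f` supported away from `E`.

To remove `E`, cover it by finitely many balls with `∑ r²` small. Cutoffs at scale `r` in space have
gradients of `L¹` norm of order `r²`, so multiplying `f` by them changes both sides by arbitrarily
little (`exists_cutoff_of_area_eq_zero`). Since `U` is bounded, compact support of `f` is no
restriction. -/

/-- The Euclidean plane. -/
abbrev Plane := EuclideanSpace ℝ (Fin 2)

/-! ### The area formula for graph-like surfaces -/

section AreaFormula

open scoped ENNReal NNReal

/-- Comparison of the Hausdorff measures of two images of the same set. -/
theorem euclideanHausdorffMeasure_image_le_of_dist_le {α X Y : Type*}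
    [MetricSpace X] [MeasurableSpace X] [BorelSpace X]
    [MetricSpace Y] [MeasurableSpace Y] [BorelSpace Y] {d : ℕ} {f : α → X} {g : α → Y}
    {s : Set α} {K : ℝ≥0} (h : ∀ x ∈ s, ∀ y ∈ s, dist (f x) (f y) ≤ K * dist (g x) (g y)) :
    Measure.euclideanHausdorffMeasure d (f '' s) ≤
      (K : ℝ≥0∞) ^ d * Measure.euclideanHausdorffMeasure d (g '' s) := by
  classical
  rcases s.eq_empty_or_nonempty with rfl | ⟨x₀, hx₀⟩
  · simp
  have : Nonempty α := ⟨x₀⟩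
  -- `g` need not be injective on `s`, but the hypothesis makes `f` constant on its fibres there, so
  -- any choice of preimages turns `f` into a `K`-Lipschitz function of `g`.
  have hinv : ∀ x ∈ s, Function.invFunOn g s (g x) ∈ s ∧ g (Function.invFunOn g s (g x)) = g x :=
    fun x hx => Function.invFunOn_pos ⟨x, hx, rfl⟩
  have hL : LipschitzOnWith K (f ∘ Function.invFunOn g s) (g '' s) := by
    refine LipschitzOnWith.of_dist_le_mul ?_
    rintro _ ⟨x, hx, rfl⟩ _ ⟨y, hy, rfl⟩
    have := h _ (hinv x hx).1 _ (hinv y hy).1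
    rwa [(hinv x hx).2, (hinv y hy).2] at this
  have him : (f ∘ Function.invFunOn g s) '' (g '' s) = f '' s := by
    rw [Set.image_image]
    refine Set.image_congr fun x hx => ?_
    have := h _ (hinv x hx).1 _ hx
    rw [(hinv x hx).2, dist_self, mul_zero] at this
    exact dist_le_zero.1 this
  have := hL.hausdorffMeasure_image_le (d := d) (Nat.cast_nonneg d)
  rw [him, ENNReal.rpow_natCast] at this
  simp only [Measure.euclideanHausdorffMeasure_def, Measure.smul_apply, ENNReal.smul_def,
    smul_eq_mul]
  calc _ ≤ _ := mul_le_mul_right this _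
    _ = _ := by ring

/-- The factor `√(1 + |ℓ|²)` by which area grows on the graph of a linear functional `ℓ`. -/
noncomputable def areaFactor (ℓ : Plane →ₗ[ℝ] ℝ) : ℝ :=
  √(1 + ℓ (EuclideanSpace.single 0 1) ^ 2 + ℓ (EuclideanSpace.single 1 1) ^ 2)

/-- A linear map between planes with Gram matrix `1 + ℓ ℓᵀ` has determinant `± √(1 + |ℓ|²)`. -/
theorem abs_det_of_inner_eq (M : Plane →ₗ[ℝ] Plane) (ℓ : Plane →ₗ[ℝ] ℝ)
    (h : ∀ k k', inner ℝ (M k) (M k') = inner ℝ k k' + ℓ k * ℓ k') :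
    |LinearMap.det M| = areaFactor ℓ := by
  rw [← Real.sqrt_sq_eq_abs, areaFactor]
  congr 1
  have h00 := h (EuclideanSpace.single 0 1) (EuclideanSpace.single 0 1)
  have h01 := h (EuclideanSpace.single 0 1) (EuclideanSpace.single 1 1)
  have h11 := h (EuclideanSpace.single 1 1) (EuclideanSpace.single 1 1)
  rw [← LinearMap.det_toMatrix (EuclideanSpace.basisFun (Fin 2) ℝ).toBasis, Matrix.det_fin_two]
  simp only [LinearMap.toMatrix_apply, OrthonormalBasis.coe_toBasis, EuclideanSpace.basisFun_apply,
    OrthonormalBasis.coe_toBasis_repr_apply, EuclideanSpace.basisFun_repr]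
  generalize M (EuclideanSpace.single 0 1) = p at *
  generalize M (EuclideanSpace.single 1 1) = q at *
  generalize ℓ (EuclideanSpace.single 0 1) = u at *
  generalize ℓ (EuclideanSpace.single 1 1) = w at *
  simp only [PiLp.inner_apply, Fin.sum_univ_two] at h00 h01 h11
  simp at h00 h01 h11
  -- The squared determinant is the Gram determinant `|p|²|q|² - ⟨p, q⟩² = (1 + u²)(1 + w²) - u²w²`.
  grind

/-- The area of the image of a set under a linear graph map. -/
theorem euclideanHausdorffMeasure_image_linear (L : Plane →ₗ[ℝ] Space3) (ℓ : Plane →ₗ[ℝ] ℝ)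
    (h : ∀ k k', inner ℝ (L k) (L k') = inner ℝ k k' + ℓ k * ℓ k') (s : Set Plane) :
    Measure.euclideanHausdorffMeasure 2 (L '' s) =
      ENNReal.ofReal (areaFactor ℓ) * volume s := by
  have hinj : Function.Injective L := by
    refine (injective_iff_map_eq_zero L).2 fun k hk => ?_
    have := h k k
    rw [hk, inner_zero_left, real_inner_self_eq_norm_sq] at this
    have h2 : ‖k‖ ^ 2 = 0 := by nlinarith [sq_nonneg ‖k‖, mul_self_nonneg (ℓ k)]
    simpa using h2
  have hfr : Module.finrank ℝ (LinearMap.range L) = 2 := by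
    rw [LinearMap.finrank_range_of_inj hinj]; simp
  -- Isometric coordinates on the range turn `L` into an endomorphism of the plane, which has a
  -- determinant, without changing areas.
  let Q : LinearMap.range L ≃ₗᵢ[ℝ] Plane :=
    ((stdOrthonormalBasis ℝ (LinearMap.range L)).reindex (finCongr hfr)).repr
  let M : Plane →ₗ[ℝ] Plane := Q.toLinearEquiv.toLinearMap ∘ₗ L.rangeRestrict
  have hM : ∀ k k', inner ℝ (M k) (M k') = inner ℝ k k' + ℓ k * ℓ k' := by
    intro k k'
    rw [← h]
    change inner ℝ (Q (L.rangeRestrict k)) (Q (L.rangeRestrict k')) = _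
    rw [LinearIsometryEquiv.inner_map_map]
    rfl
  have hi : Isometry fun y : Plane => ((Q.symm y : LinearMap.range L) : Space3) :=
    isometry_subtype_coe.comp Q.symm.isometry
  have himg : L '' s = (fun y : Plane => ((Q.symm y : LinearMap.range L) : Space3)) '' (M '' s) := by
    rw [Set.image_image]
    refine Set.image_congr fun k _ => ?_
    change _ = ((Q.symm (Q (L.rangeRestrict k)) : LinearMap.range L) : Space3)
    simp
  rw [himg, hi.euclideanHausdorffMeasure_image,
    EuclideanSpace.euclideanHausdorffMeasure_eq_volume, Measure.addHaar_image_linearMap,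
    abs_det_of_inner_eq M ℓ hM]



/-- Near a point of strict differentiability, the area of the image of a set is comparable to the
area of its image under the derivative, with constants close to one. -/
theorem exists_nhds_area_image_comparable {Γ : Plane → Space3} {L : Plane →L[ℝ] Space3}
    {ℓ : Plane →ₗ[ℝ] ℝ} {y : Plane} (hΓ : HasStrictFDerivAt Γ L y)
    (h : ∀ k k', inner ℝ (L k) (L k') = inner ℝ k k' + ℓ k * ℓ k') {K : ℝ≥0} (hK : 1 < K) :
    ∃ s ∈ 𝓝 y, ∀ A ⊆ s,
      Measure.euclideanHausdorffMeasure 2 (Γ '' A) ≤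
        (K : ℝ≥0∞) ^ 2 * (ENNReal.ofReal (areaFactor ℓ) * volume A) ∧
      ENNReal.ofReal (areaFactor ℓ) * volume A ≤
        (K : ℝ≥0∞) ^ 2 * Measure.euclideanHausdorffMeasure 2 (Γ '' A) := by
  have hK' : (1 : ℝ) < K := by exact_mod_cast hK
  have hK0 : (0 : ℝ) < K := by linarith
  -- With relative error `1 - K⁻¹` the lower distortion is exactly `K⁻¹` and the upper one is `2 -
  -- K⁻¹ ≤ K`.
  have hε : 0 < 1 - (K : ℝ)⁻¹ := sub_pos.2 (inv_lt_one_of_one_lt₀ hK')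
  -- Since `L` does not shrink vectors, an error small relative to `z - w` is also small relative to
  -- `L (z - w)`.
  have hLn : ∀ k, ‖k‖ ≤ ‖L k‖ := by
    intro k
    have h1 := h k k
    rw [real_inner_self_eq_norm_sq, real_inner_self_eq_norm_sq] at h1
    refine le_of_sq_le_sq ?_ (norm_nonneg _)
    nlinarith [mul_self_nonneg (ℓ k)]
  have hev := hΓ.isLittleO.bound hε
  rw [nhds_prod_eq] at hev
  obtain ⟨s, hs, hsub⟩ := (Filter.mem_prod_same_iff).1 hev
  refine ⟨s, hs, fun A hA => ?_⟩
  have hb : ∀ z ∈ A, ∀ w ∈ A,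
      ‖Γ z - Γ w - L (z - w)‖ ≤ (1 - (K : ℝ)⁻¹) * ‖L (z - w)‖ := fun z hz w hw =>
    (hsub (Set.mk_mem_prod (hA hz) (hA hw))).trans
      (mul_le_mul_of_nonneg_left (hLn _) hε.le)
  have himg := euclideanHausdorffMeasure_image_linear L.toLinearMap ℓ h A
  have h1 : Measure.euclideanHausdorffMeasure 2 (Γ '' A) ≤
      (K : ℝ≥0∞) ^ 2 * Measure.euclideanHausdorffMeasure 2 (L '' A) := by
    refine euclideanHausdorffMeasure_image_le_of_dist_le fun z hz w hw => ?_
    rw [dist_eq_norm, dist_eq_norm, ← map_sub]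
    have h2 := hb z hz w hw
    have h3 := norm_sub_norm_le (Γ z - Γ w) (L (z - w))
    have h4 : 2 - (K : ℝ)⁻¹ ≤ K := by
      have : (K : ℝ) * (K : ℝ)⁻¹ = 1 := mul_inv_cancel₀ hK0.ne'
      nlinarith [inv_pos.2 hK0]
    nlinarith [norm_nonneg (L (z - w))]
  have h2 : Measure.euclideanHausdorffMeasure 2 (L '' A) ≤
      (K : ℝ≥0∞) ^ 2 * Measure.euclideanHausdorffMeasure 2 (Γ '' A) := by
    refine euclideanHausdorffMeasure_image_le_of_dist_le fun z hz w hw => ?_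
    rw [dist_eq_norm, dist_eq_norm, ← map_sub]
    have h2 := hb z hz w hw
    have h3 := norm_sub_norm_le (L (z - w)) (Γ z - Γ w)
    rw [norm_sub_rev (L (z - w))] at h3
    have h5 : (K : ℝ)⁻¹ * ‖L (z - w)‖ ≤ ‖Γ z - Γ w‖ := by linarith
    rwa [inv_mul_le_iff₀ hK0] at h5
  rw [show (L.toLinearMap : Plane → Space3) = L from rfl] at himg
  rw [himg] at h1 h2
  exact ⟨h1, h2⟩

/-- Let `K` tend to one; this removes the distortion constants from the local comparison. -/
theorem ENNReal.le_of_forall_one_lt_sq_mul_le {a b : ℝ≥0∞}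
    (h : ∀ K : ℝ≥0, 1 < K → a ≤ (K : ℝ≥0∞) ^ 2 * b) : a ≤ b := by
  rcases eq_or_ne b ⊤ with rfl | hb
  · exact le_top
  have ht : Tendsto (fun K : ℝ≥0 => (K : ℝ≥0∞) ^ 2 * b) (𝓝[>] 1) (𝓝 (((1 : ℝ≥0) : ℝ≥0∞) ^ 2 * b)) := by
    refine ENNReal.Tendsto.mul_const ?_ (Or.inr hb)
    exact ((ENNReal.continuous_pow 2).comp ENNReal.continuous_coe).tendsto 1 |>.mono_left
      nhdsWithin_le_nhds
  simp only [ENNReal.coe_one, one_pow, one_mul] at ht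
  exact ge_of_tendsto ht (by filter_upwards [self_mem_nhdsWithin] with K hK using h K hK)

/-- The area formula for a parametrized `C¹` surface of finite area whose derivatives are graphs
over the plane up to isometry, and which has a continuous left inverse `π`. -/
theorem setIntegral_image_eq_setIntegral_areaFactor {Γ : Plane → Space3}
    {L : Plane → Plane →L[ℝ] Space3} {ℓ : Plane → Plane →ₗ[ℝ] ℝ} {B : Set Plane} (hB : IsOpen B)
    {π : Space3 → Plane} (hπ : Continuous π) (hπΓ : ∀ y ∈ B, π (Γ y) = y)
    (hΓ : ∀ y ∈ B, HasStrictFDerivAt Γ (L y) y)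
    (hL : ∀ y ∈ B, ∀ k k', inner ℝ (L y k) (L y k') = inner ℝ k k' + ℓ y k * ℓ y k')
    (hfin : Measure.euclideanHausdorffMeasure 2 (Γ '' B) < ⊤) {F : Space3 → ℝ}
    (hF : ContinuousOn F (Γ '' B)) :
    ∫ x in Γ '' B, F x ∂Measure.euclideanHausdorffMeasure 2 =
      ∫ y in B, areaFactor (ℓ y) * F (Γ y) := by
  have hcont : ContinuousOn Γ B := fun y hy => (hΓ y hy).continuousAt.continuousWithinAt
  have hinj : Set.InjOn Γ B := fun y hy z hz hyz => by rw [← hπΓ y hy, hyz, hπΓ z hz]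
  have hmeas : MeasurableSet (Γ '' B) := hB.measurableSet.image_of_continuousOn_injOn hcont hinj
  set μ := (Measure.euclideanHausdorffMeasure 2).restrict (Γ '' B) with hμ
  have : IsFiniteMeasure μ := ⟨by rw [hμ, Measure.restrict_apply_univ]; exact hfin⟩
  -- Surface area transported to the parameter plane. The area formula then says that its density is
  -- the area factor.
  set lam := μ.map π with hlam
  have hlam_apply : ∀ A, MeasurableSet A →
      lam A = Measure.euclideanHausdorffMeasure 2 (Γ '' (A ∩ B)) := by
    intro A hA
    rw [hlam, Measure.map_apply hπ.measurable hA, hμ,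
      Measure.restrict_apply (hπ.measurable hA)]
    congr 1
    ext x
    constructor
    · rintro ⟨hx, y, hy, rfl⟩
      exact ⟨y, ⟨by simpa [hπΓ y hy] using hx, hy⟩, rfl⟩
    · rintro ⟨y, ⟨hyA, hyB⟩, rfl⟩
      exact ⟨by simpa [hπΓ y hyB] using hyA, y, hyB, rfl⟩
  have hres : lam.restrict B = lam := by
    refine Measure.restrict_eq_self_of_ae_mem ?_
    rw [hlam, ae_map_iff (p := (· ∈ B)) hπ.aemeasurable hB.measurableSet, hμ]
    filter_upwards [ae_restrict_mem hmeas] with x hx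
    obtain ⟨y, hy, rfl⟩ := hx
    rwa [hπΓ y hy]
  have hac : lam ≪ volume := by
    refine Measure.AbsolutelyContinuous.mk fun A hA hA0 => ?_
    rw [← hres, Measure.restrict_apply hA]
    refine measure_null_of_locally_null _ fun y hy => ?_
    obtain ⟨s, hs, hcomp⟩ := exists_nhds_area_image_comparable (hΓ y hy.2) (hL y hy.2) one_lt_two
    refine ⟨interior s ∩ (A ∩ B), inter_mem (mem_nhdsWithin_of_mem_nhds (interior_mem_nhds.2 hs))
      self_mem_nhdsWithin, ?_⟩
    rw [hlam_apply _ (isOpen_interior.measurableSet.inter (hA.inter hB.measurableSet))]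
    refine le_antisymm ((hcomp _ ?_).1.trans ?_) zero_le
    · exact fun z hz => interior_subset hz.1.1
    · rw [measure_mono_null (fun z hz => hz.1.2.1) hA0]
      simp
  have hdens : ∀ᵐ y ∂(volume.restrict B), lam.rnDeriv volume y =
      ENNReal.ofReal (areaFactor (ℓ y)) := by
    rw [ae_restrict_iff' hB.measurableSet]
    -- Almost everywhere the density is the limit of ratios of measures of small balls, and the
    -- local comparison squeezes these ratios for every `K > 1`.
    filter_upwards [Besicovitch.ae_tendsto_rnDeriv lam volume] with y hy hyB
    have hpos : ∀ r ∈ Set.Ioi (0 : ℝ), volume (Metric.closedBall y r) ≠ 0 ∧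
        volume (Metric.closedBall y r) ≠ ⊤ := fun r hr =>
      ⟨(Metric.measure_closedBall_pos _ _ hr).ne', measure_closedBall_lt_top.ne⟩
    have key : ∀ K : ℝ≥0, 1 < K → ∀ᶠ r in 𝓝[>] (0 : ℝ),
        lam (Metric.closedBall y r) / volume (Metric.closedBall y r) ≤
          (K : ℝ≥0∞) ^ 2 * ENNReal.ofReal (areaFactor (ℓ y)) ∧
        ENNReal.ofReal (areaFactor (ℓ y)) ≤ (K : ℝ≥0∞) ^ 2 *
          (lam (Metric.closedBall y r) / volume (Metric.closedBall y r)) := by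
      intro K hK
      obtain ⟨s, hs, hcomp⟩ := exists_nhds_area_image_comparable (hΓ y hyB) (hL y hyB) hK
      obtain ⟨δ, hδ, hδs⟩ := Metric.nhds_basis_closedBall.mem_iff.1
        (Filter.inter_mem hs (hB.mem_nhds hyB))
      filter_upwards [Ioc_mem_nhdsGT hδ] with r hr
      have hsub := (Metric.closedBall_subset_closedBall hr.2).trans hδs
      have hc := hcomp _ (hsub.trans Set.inter_subset_left)
      rw [hlam_apply _ Metric.isClosed_closedBall.measurableSet,
        Set.inter_eq_left.2 (hsub.trans Set.inter_subset_right)]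
      obtain ⟨h0, ht⟩ := hpos r hr.1
      refine ⟨ENNReal.div_le_of_le_mul ?_, ?_⟩
      · rw [mul_assoc]; exact hc.1
      · rw [← mul_div_assoc]
        exact (ENNReal.le_div_iff_mul_le (Or.inl h0) (Or.inl ht)).2 hc.2
    refine le_antisymm ?_ ?_
    · refine ENNReal.le_of_forall_one_lt_sq_mul_le fun K hK => ?_
      exact le_of_tendsto hy ((key K hK).mono fun r hr => hr.1)
    · refine ENNReal.le_of_forall_one_lt_sq_mul_le fun K hK => ?_
      exact ge_of_tendsto (ENNReal.Tendsto.const_mul hy (Or.inr (by finiteness)))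
        ((key K hK).mono fun r hr => hr.2)
  have hwd : lam = (volume.restrict B).withDensity (lam.rnDeriv volume) := by
    rw [← restrict_withDensity hB.measurableSet, Measure.withDensity_rnDeriv_eq _ _ hac, hres]
  have hFΓ : AEStronglyMeasurable (fun y => F (Γ y)) lam := by
    rw [← hres]
    exact (hF.comp hcont (Set.mapsTo_image Γ B)).aestronglyMeasurable hB.measurableSet
  calc ∫ x, F x ∂μ = ∫ x, F (Γ (π x)) ∂μ := by
        refine integral_congr_ae ?_
        filter_upwards [ae_restrict_mem hmeas] with x hx
        obtain ⟨y, hy, rfl⟩ := hx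
        rw [hπΓ y hy]
    _ = ∫ y, F (Γ y) ∂lam := (integral_map hπ.aemeasurable hFΓ).symm
    _ = ∫ y, (lam.rnDeriv volume y).toReal • F (Γ y) ∂(volume.restrict B) := by
        conv_lhs => rw [hwd]
        exact integral_withDensity_eq_integral_toReal_smul (Measure.measurable_rnDeriv _ _)
          (ae_restrict_of_ae (Measure.rnDeriv_lt_top _ _)) _
    _ = ∫ y in B, areaFactor (ℓ y) * F (Γ y) := by
        refine integral_congr_ae ?_
        filter_upwards [hdens] with y hy
        rw [hy, ENNReal.toReal_ofReal (by exact Real.sqrt_nonneg _), smul_eq_mul]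

end AreaFormula

/-! ### Defining functions and the regular part of the boundary -/

section Normal

theorem IsOutwardUnitNormal.outwardNormal_eq {U : Set Space3} {x n : Space3}
    (h : IsOutwardUnitNormal U x n) : outwardNormal U x = n := by
  have hex : ∃ n, IsOutwardUnitNormal U x n := ⟨n, h⟩
  rw [outwardNormal, dif_pos hex]
  exact hex.choose_spec.unique h

theorem IsOutwardUnitNormal.norm_eq_one {U : Set Space3} {x n : Space3}
    (h : IsOutwardUnitNormal U x n) : ‖n‖ = 1 := by
  obtain ⟨φ, -, -, hg, -, rfl⟩ := h
  rw [norm_smul, norm_inv, norm_norm, inv_mul_cancel₀ (norm_ne_zero_iff.2 hg)]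

theorem norm_outwardNormal_le_one (U : Set Space3) (x : Space3) : ‖outwardNormal U x‖ ≤ 1 := by
  by_cases hex : ∃ n, IsOutwardUnitNormal U x n
  · obtain ⟨n, hn⟩ := hex
    rw [hn.outwardNormal_eq, hn.norm_eq_one]
  · rw [outwardNormal, dif_neg hex]; simp

/-- `φ` is a `C¹` defining function of `U` near `y`, regular at `y`. -/
def IsDefiningFunctionAt (U : Set Space3) (φ : Space3 → ℝ) (y : Space3) : Prop :=
  ContDiffAt ℝ 1 φ y ∧ ∇ φ y ≠ 0 ∧ ∀ᶠ z in 𝓝 y, z ∈ U ↔ φ z ≤ 0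

theorem ContDiffAt.continuousAt_gradient {φ : Space3 → ℝ} {x : Space3} (h : ContDiffAt ℝ 1 φ x) :
    ContinuousAt (∇ φ) x := by
  have h1 : ContinuousAt (fderiv ℝ φ) x := h.continuousAt_fderiv one_ne_zero
  exact (InnerProductSpace.toDual ℝ Space3).symm.continuous.continuousAt.comp h1

theorem inner_gradient_eq_fderiv {φ : Space3 → ℝ} {x : Space3} (k : Space3) :
    inner ℝ (∇ φ x) k = fderiv ℝ φ x k := by
  rw [gradient, InnerProductSpace.toDual_symm_apply]

/-- All the conditions are open, since `φ y = 0` is not among them; hence one `φ` describes `U` and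
its normal at all nearby boundary points. -/
theorem IsDefiningFunctionAt.eventually {U : Set Space3} {φ : Space3 → ℝ} {x : Space3}
    (h : IsDefiningFunctionAt U φ x) : ∀ᶠ y in 𝓝 x, IsDefiningFunctionAt U φ y :=
  (h.1.eventually (by simp)).and
    ((h.1.continuousAt_gradient.eventually_ne h.2.1).and (eventually_eventually_nhds.2 h.2.2))

/-- Points with `φ < 0` are interior and points with `φ > 0` exterior. A zero interior to `U` would
be a local maximum of `φ`, contradicting the nonzero gradient. -/
theorem IsDefiningFunctionAt.mem_frontier_iff {U : Set Space3} {φ : Space3 → ℝ} {y : Space3}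
    (h : IsDefiningFunctionAt U φ y) : y ∈ frontier U ↔ φ y = 0 := by
  constructor
  · intro hy
    rcases lt_trichotomy (φ y) 0 with hlt | h0 | hgt
    · refine absurd ?_ hy.2
      rw [mem_interior_iff_mem_nhds]
      filter_upwards [h.2.2, h.1.continuousAt.eventually (gt_mem_nhds hlt)] with z hz hz'
      exact hz.2 hz'.le
    · exact h0
    · have : y ∈ interior Uᶜ := by
        rw [mem_interior_iff_mem_nhds]
        filter_upwards [h.2.2, h.1.continuousAt.eventually (lt_mem_nhds hgt)] with z hz hz' hzU
        exact absurd (hz.1 hzU) (not_le.2 hz')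
      rw [interior_compl] at this
      exact absurd hy.1 this
  · intro h0
    refine ⟨subset_closure (h.2.2.self_of_nhds.2 h0.le), fun hint => h.2.1 ?_⟩
    have hmax : IsLocalMax φ y := by
      filter_upwards [h.2.2, mem_interior_iff_mem_nhds.1 hint] with z hz hzU
      rw [h0]
      exact hz.1 hzU
    rw [gradient, hmax.fderiv_eq_zero, map_zero]

theorem IsDefiningFunctionAt.isOutwardUnitNormal {U : Set Space3} {φ : Space3 → ℝ} {y : Space3}
    (h : IsDefiningFunctionAt U φ y) (hy : y ∈ frontier U) :
    IsOutwardUnitNormal U y (‖∇ φ y‖⁻¹ • ∇ φ y) :=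
  ⟨φ, h.1, h.mem_frontier_iff.1 hy, h.2.1, h.2.2, rfl⟩

theorem IsOutwardUnitNormal.exists_isDefiningFunctionAt {U : Set Space3} {x n : Space3}
    (h : IsOutwardUnitNormal U x n) :
    ∃ φ, IsDefiningFunctionAt U φ x ∧ φ x = 0 ∧ n = ‖∇ φ x‖⁻¹ • ∇ φ x := by
  obtain ⟨φ, h1, h2, h3, h4, h5⟩ := h
  exact ⟨φ, ⟨h1, h3, h4⟩, h2, h5⟩

/-- The points of the boundary at which there is an outward unit normal. -/
def regularBoundary (U : Set Space3) : Set Space3 :=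
  {x ∈ frontier U | ∃ n, IsOutwardUnitNormal U x n}

theorem eventually_mem_regularBoundary {U : Set Space3} {x : Space3} (hx : x ∈ regularBoundary U) :
    ∀ᶠ y in 𝓝[frontier U] x, y ∈ regularBoundary U := by
  obtain ⟨-, n, hn⟩ := hx
  obtain ⟨φ, hφ, -⟩ := hn.exists_isDefiningFunctionAt
  filter_upwards [nhdsWithin_le_nhds hφ.eventually, self_mem_nhdsWithin] with y hy hyf
  exact ⟨hyf, _, hy.isOutwardUnitNormal hyf⟩

/-- Regularity is an open condition within the boundary. For compact `U` the singular set is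
therefore compact, as the finite covering by balls requires. -/
theorem isClosed_frontier_diff_regularBoundary (U : Set Space3) :
    IsClosed (frontier U \ regularBoundary U) := by
  rw [← isOpen_compl_iff, isOpen_iff_mem_nhds]
  intro x hx
  by_cases hxf : x ∈ frontier U
  · have hxr : x ∈ regularBoundary U := by
      by_contra hcon
      exact hx ⟨hxf, hcon⟩
    filter_upwards [eventually_nhdsWithin_iff.1 (eventually_mem_regularBoundary hxr)] with y hy
    exact fun h => h.2 (hy h.1)
  · filter_upwards [isClosed_frontier.isOpen_compl.mem_nhds hxf] with y hy
    exact fun h => hy h.1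

theorem measurableSet_regularBoundary (U : Set Space3) : MeasurableSet (regularBoundary U) := by
  have : regularBoundary U = frontier U \ (frontier U \ regularBoundary U) := by
    rw [Set.sdiff_sdiff_cancel_left]
    exact fun x hx => hx.1
  rw [this]
  exact isClosed_frontier.measurableSet.diff (isClosed_frontier_diff_regularBoundary U).measurableSet

/-- Near a regular point the normal is the normalized gradient of a single `C¹` function. -/
theorem continuousOn_outwardNormal (U : Set Space3) :
    ContinuousOn (outwardNormal U) (regularBoundary U) := by
  intro x hx
  obtain ⟨φ, hφ, h0, -⟩ := hx.2.choose_spec.exists_isDefiningFunctionAt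
  have hc : ContinuousAt (fun y => ‖∇ φ y‖⁻¹ • ∇ φ y) x :=
    (hφ.1.continuousAt_gradient.norm.inv₀ (norm_ne_zero_iff.2 hφ.2.1)).smul
      hφ.1.continuousAt_gradient
  refine hc.continuousWithinAt.congr_of_eventuallyEq ?_
    (hφ.isOutwardUnitNormal hx.1).outwardNormal_eq
  filter_upwards [nhdsWithin_le_nhds hφ.eventually, self_mem_nhdsWithin] with y hy hyr
  exact (hy.isOutwardUnitNormal hyr.1).outwardNormal_eq

end Normal

/-! ### Local description of the set as a subgraph -/

section Graph

/-- Orthogonal coordinates of space in which a given unit vector is the vertical direction. -/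
theorem exists_orthogonal_coordinates {v : Space3} (hv : ‖v‖ = 1) :
    ∃ e : (Plane × ℝ) ≃L[ℝ] Space3, e (0, 1) = v ∧
      (∀ p q, inner ℝ (e p) (e q) = inner ℝ p.1 q.1 + p.2 * q.2) ∧
      MeasurePreserving e volume volume := by
  have hv0 : v ≠ 0 := norm_ne_zero_iff.1 (by rw [hv]; exact one_ne_zero)
  have : Fact (Module.finrank ℝ Space3 = 2 + 1) := ⟨by simp⟩
  have hfr : Module.finrank ℝ (ℝ ∙ v)ᗮ = 2 := Submodule.finrank_orthogonal_span_singleton hv0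
  let o : (ℝ ∙ v)ᗮ ≃ₗᵢ[ℝ] Plane :=
    ((stdOrthonormalBasis ℝ (ℝ ∙ v)ᗮ).reindex (finCongr hfr)).repr
  have horth : ∀ y : (ℝ ∙ v)ᗮ, inner ℝ (y : Space3) v = 0 := fun y => by
    rw [real_inner_comm]
    exact Submodule.mem_orthogonal_singleton_iff_inner_right.1 y.2
  -- The plain product carries the sup norm; the isometry exists only for the `L²` product and is
  -- transferred afterwards.
  let S : WithLp 2 (Plane × ℝ) →ₗᵢ[ℝ] Space3 :=
    { toFun := fun p => (o.symm p.fst : Space3) + p.snd • v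
      map_add' := fun p q => by simp [add_smul]; abel
      map_smul' := fun c p => by simp [mul_smul]
      norm_map' := fun p => by
        change ‖(o.symm p.fst : Space3) + p.snd • v‖ = ‖p‖
        rw [← sq_eq_sq₀ (norm_nonneg _) (norm_nonneg _), WithLp.prod_norm_sq_eq_of_L2,
          norm_add_sq_real, inner_smul_right, horth, norm_smul, hv, ← Submodule.coe_norm,
          LinearIsometryEquiv.norm_map]
        simp }
  let T := S.toLinearIsometryEquiv (by
    rw [(WithLp.linearEquiv 2 ℝ (Plane × ℝ)).finrank_eq]; simp)
  refine ⟨(WithLp.prodContinuousLinearEquiv 2 ℝ Plane ℝ).symm.trans T.toContinuousLinearEquiv,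
    ?_, ?_, ?_⟩
  · change (o.symm (0 : Plane) : Space3) + (1 : ℝ) • v = v
    simp
  · intro p q
    change inner ℝ (T (WithLp.toLp 2 p)) (T (WithLp.toLp 2 q)) = _
    rw [LinearIsometryEquiv.inner_map_map, WithLp.prod_inner_apply]
    simp [mul_comm]
  · exact T.measurePreserving.comp (WithLp.volume_preserving_toLp Plane ℝ)

/-- Near a zero at which the vertical derivative is positive, the sublevel set of a `C¹` function
is a subgraph over a box. -/
theorem exists_subgraph_box {ψ : Plane × ℝ → ℝ} {u : Plane × ℝ} (hψ : ContDiffAt ℝ 1 ψ u)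
    (h0 : ψ u = 0) (hpos : 0 < fderiv ℝ ψ u (0, 1)) {N : Set (Plane × ℝ)} (hN : N ∈ 𝓝 u) :
    ∃ (a b : ℝ) (g : Plane → ℝ), 0 < a ∧ 0 < b ∧
      Metric.ball u.1 b ×ˢ Set.Icc (u.2 - a) (u.2 + a) ⊆ N ∧
      ∀ y ∈ Metric.ball u.1 b, g y ∈ Set.Ioo (u.2 - a) (u.2 + a) ∧
        (∀ t ∈ Set.Icc (u.2 - a) (u.2 + a), ψ (y, t) ≤ 0 ↔ t ≤ g y) ∧
        (∀ t ∈ Set.Icc (u.2 - a) (u.2 + a), ψ (y, t) = 0 ↔ t = g y) ∧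
        0 < fderiv ℝ ψ (y, g y) (0, 1) ∧
        HasStrictFDerivAt g (-(fderiv ℝ ψ (y, g y) (0, 1))⁻¹ •
          (fderiv ℝ ψ (y, g y)).comp (ContinuousLinearMap.inl ℝ Plane ℝ)) y := by
  have hinv : (fderiv ℝ ψ u ∘L .inr ℝ Plane ℝ).IsInvertible := by
    refine ⟨ContinuousLinearEquiv.unitsEquivAut ℝ (Units.mk0 _ hpos.ne'), ?_⟩
    ext
    simp
  set g := hψ.implicitFunction one_ne_zero hinv with hg
  have hgu : g u.1 = u.2 := hψ.implicitFunction_apply_self one_ne_zero hinv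
  have hgC : ContDiffAt ℝ 1 g u.1 := hψ.contDiffAt_implicitFunction one_ne_zero hinv
  have hev : ∀ᶠ p in 𝓝 u, p ∈ N ∧ ContDiffAt ℝ 1 ψ p ∧ 0 < fderiv ℝ ψ p (0, 1) ∧
      (ψ p = 0 ↔ g p.1 = p.2) := by
    refine (eventually_mem_set.2 hN).and ((hψ.eventually (by simp)).and (Eventually.and ?_ ?_))
    · have : ContinuousAt (fun p => fderiv ℝ ψ p (0, 1)) u :=
        (hψ.continuousAt_fderiv one_ne_zero).clm_apply continuousAt_const
      exact this.eventually (lt_mem_nhds hpos)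
    · have := hψ.eventually_apply_eq_iff_implicitFunction one_ne_zero hinv
      rwa [h0] at this
  rw [← Prod.mk.eta (p := u), nhds_prod_eq] at hev
  obtain ⟨s, hs, t, ht, hsub⟩ := Filter.mem_prod_iff.1 hev
  obtain ⟨a, ha, hat⟩ := Metric.nhds_basis_closedBall.mem_iff.1 ht
  rw [Real.closedBall_eq_Icc] at hat
  -- The height `a` is fixed first; the base is then shrunk so that the graph stays strictly inside
  -- the box.
  have hev2 : ∀ᶠ y in 𝓝 u.1, y ∈ s ∧ ContDiffAt ℝ 1 g y ∧ g y ∈ Set.Ioo (u.2 - a) (u.2 + a) := by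
    refine (eventually_mem_set.2 hs).and ((hgC.eventually (by simp)).and ?_)
    refine hgC.continuousAt.eventually (Ioo_mem_nhds ?_ ?_) <;> rw [hgu] <;> linarith
  obtain ⟨b, hb, hbs⟩ := Metric.mem_nhds_iff.1 hev2
  refine ⟨a, b, g, ha, hb, fun p hp => (hsub (Set.mk_mem_prod (hbs hp.1).1 (hat hp.2))).1, ?_⟩
  intro y hy
  obtain ⟨hys, hyC, hyI⟩ := hbs hy
  have hbox : ∀ t ∈ Set.Icc (u.2 - a) (u.2 + a), ContDiffAt ℝ 1 ψ (y, t) ∧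
      0 < fderiv ℝ ψ (y, t) (0, 1) ∧ (ψ (y, t) = 0 ↔ g y = t) := fun t ht =>
    (hsub (Set.mk_mem_prod hys (hat ht))).2
  have hderiv : ∀ t ∈ Set.Icc (u.2 - a) (u.2 + a),
      HasDerivAt (fun t => ψ (y, t)) (fderiv ℝ ψ (y, t) (0, 1)) t := fun t ht =>
    ((hbox t ht).1.differentiableAt one_ne_zero).hasFDerivAt.comp_hasDerivAt t
      ((hasDerivAt_const t y).prodMk (hasDerivAt_id t))
  -- Strict monotonicity along verticals upgrades the description of the zero set to one of the
  -- sublevel set.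
  have hmono : StrictMonoOn (fun t => ψ (y, t)) (Set.Icc (u.2 - a) (u.2 + a)) := by
    refine strictMonoOn_of_deriv_pos (convex_Icc _ _)
      (fun t ht => (hderiv t ht).continuousAt.continuousWithinAt) fun t ht => ?_
    rw [(hderiv t (interior_subset ht)).deriv]
    exact (hbox t (interior_subset ht)).2.1
  have hyI' := Set.Ioo_subset_Icc_self hyI
  have hgy : ψ (y, g y) = 0 := (hbox _ hyI').2.2.2 rfl
  refine ⟨hyI, fun t ht => ?_, fun t ht => (hbox t ht).2.2.trans eq_comm, (hbox _ hyI').2.1, ?_⟩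
  · rw [← hgy]
    exact hmono.le_iff_le ht hyI'
  · have hst := hyC.hasStrictFDerivAt one_ne_zero
    suffices hEq : -(fderiv ℝ ψ (y, g y) (0, 1))⁻¹ •
        (fderiv ℝ ψ (y, g y)).comp (ContinuousLinearMap.inl ℝ Plane ℝ) = fderiv ℝ g y by
      rw [hEq]; exact hst
    -- Differentiating `ψ (z, g z) = 0` identifies the derivative of `g`.
    have hcomp : HasFDerivAt (fun z => ψ (z, g z))
        ((fderiv ℝ ψ (y, g y)).comp ((ContinuousLinearMap.id ℝ Plane).prod (fderiv ℝ g y))) y :=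
      ((hbox _ hyI').1.differentiableAt one_ne_zero).hasFDerivAt.comp y
        ((hasFDerivAt_id y).prodMk hst.hasFDerivAt)
    have hzero : HasFDerivAt (fun z => ψ (z, g z)) (0 : Plane →L[ℝ] ℝ) y := by
      refine (hasFDerivAt_const (0 : ℝ) y).congr_of_eventuallyEq ?_
      filter_upwards [Metric.isOpen_ball.mem_nhds hy] with z hz
      obtain ⟨hzs, -, hzI⟩ := hbs hz
      exact (hsub (Set.mk_mem_prod hzs (hat (Set.Ioo_subset_Icc_self hzI)))).2.2.2.2 rfl
    refine ContinuousLinearMap.ext fun k => ?_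
    have hk := DFunLike.congr_fun (hcomp.unique hzero) k
    have hsplit : fderiv ℝ ψ (y, g y) (k, fderiv ℝ g y k) =
        fderiv ℝ ψ (y, g y) (k, 0) + fderiv ℝ g y k * fderiv ℝ ψ (y, g y) (0, 1) := by
      rw [← smul_eq_mul, ← map_smul, ← map_add]
      simp
    have hc := (hbox _ hyI').2.1.ne'
    simp only [ContinuousLinearMap.comp_apply, ContinuousLinearMap.prod_apply,
      ContinuousLinearMap.id_apply, _root_.zero_apply] at hk
    rw [hsplit] at hk
    change -(fderiv ℝ ψ (y, g y) (0, 1))⁻¹ * fderiv ℝ ψ (y, g y) (k, 0) = _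
    field_simp
    linarith

end Graph

/-! ### Gauss–Green near a regular point, in transversal directions -/

section LocalGaussGreen

/-- Write `G = e (w, s)`, so `s = c`. The graph has slope `-w / s` and area factor `‖G‖ / s`, while
the vertical component of the unit normal is `s / ‖G‖`. -/
theorem areaFactor_mul_inner_normal {e : (Plane × ℝ) ≃L[ℝ] Space3}
    (he : ∀ p q, inner ℝ (e p) (e q) = inner ℝ p.1 q.1 + p.2 * q.2) {G : Space3} {c : ℝ}
    (hc : 0 < c) (hcG : inner ℝ G (e (0, 1)) = c) {ℓ : Plane →ₗ[ℝ] ℝ}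
    (hℓ : ∀ k, ℓ k = -c⁻¹ * inner ℝ G (e (k, 0))) :
    areaFactor ℓ * inner ℝ (e (0, 1)) (‖G‖⁻¹ • G) = 1 := by
  obtain ⟨⟨w, s⟩, rfl⟩ := e.surjective G
  rw [he] at hcG
  simp only [inner_zero_right, zero_add, mul_one] at hcG
  subst hcG
  have hG : ‖e (w, s)‖ ^ 2 = w 0 ^ 2 + w 1 ^ 2 + s ^ 2 := by
    rw [← real_inner_self_eq_norm_sq, he, real_inner_self_eq_norm_sq, EuclideanSpace.norm_sq_eq,
      Fin.sum_univ_two]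
    simp [pow_two]
  have hGpos : 0 < ‖e (w, s)‖ := by
    have : 0 < ‖e (w, s)‖ ^ 2 := by rw [hG]; positivity
    exact (norm_nonneg _).lt_of_ne fun h => by rw [← h] at this; norm_num at this
  have h0 : ℓ (EuclideanSpace.single 0 1) = -s⁻¹ * w 0 := by
    rw [hℓ, he]; simp [EuclideanSpace.inner_single_right]
  have h1 : ℓ (EuclideanSpace.single 1 1) = -s⁻¹ * w 1 := by
    rw [hℓ, he]; simp [EuclideanSpace.inner_single_right]
  have hJ : areaFactor ℓ = ‖e (w, s)‖ / s := by
    rw [areaFactor, h0, h1]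
    rw [← Real.sqrt_sq (by positivity : 0 ≤ ‖e (w, s)‖ / s), div_pow, hG]
    congr 1
    field_simp
    ring
  rw [hJ, inner_smul_right, he]
  simp only [inner_zero_left, zero_add, one_mul]
  field_simp

/-- The volume side of the local Gauss–Green formula: integration along vertical lines. -/
theorem integral_fderiv_subgraph {U : Set Space3} (hU : MeasurableSet U) {v : Space3}
    {e : (Plane × ℝ) ≃L[ℝ] Space3} (hev : e (0, 1) = v)
    (hmp : MeasurePreserving e volume volume) {B : Set Plane} (hB : IsOpen B) {l r : ℝ}
    {g : Plane → ℝ} (hg : ∀ y ∈ B, g y ∈ Set.Ioo l r)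
    (hUg : ∀ y ∈ B, ∀ t ∈ Set.Icc l r, e (y, t) ∈ U ↔ t ≤ g y) {f : Space3 → ℝ}
    (hf : ContDiff ℝ 1 f) (hfc : HasCompactSupport f)
    (hfs : tsupport f ⊆ e '' (B ×ˢ Set.Ioo l r)) :
    ∫ x in U, fderiv ℝ f x v = ∫ y in B, f (e (y, g y)) := by
  classical
  have hd : ∀ y t, HasDerivAt (fun t => f (e (y, t))) (fderiv ℝ f (e (y, t)) v) t := by
    intro y t
    have h1 : HasDerivAt (fun t : ℝ => e (y, t)) v t := by
      rw [← hev]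
      exact e.hasFDerivAt.comp_hasDerivAt t ((hasDerivAt_const t y).prodMk (hasDerivAt_id t))
    exact ((hf.differentiable one_ne_zero) _).hasFDerivAt.comp_hasDerivAt t h1
  have hout : ∀ y t, ¬ (y ∈ B ∧ t ∈ Set.Ioo l r) → e (y, t) ∉ tsupport f := by
    intro y t hyt hcon
    obtain ⟨p, hp, hpe⟩ := hfs hcon
    rw [e.injective hpe] at hp
    exact hyt hp
  have hf0 : ∀ y t, ¬ (y ∈ B ∧ t ∈ Set.Ioo l r) → f (e (y, t)) = 0 := fun y t h =>
    image_eq_zero_of_notMem_tsupport (hout y t h)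
  have hd0 : ∀ y t, ¬ (y ∈ B ∧ t ∈ Set.Ioo l r) → fderiv ℝ f (e (y, t)) v = 0 := fun y t h => by
    rw [image_eq_zero_of_notMem_tsupport (fun hc => hout y t h (tsupport_fderiv_subset ℝ hc))]
    rfl
  have hcont : Continuous fun x => fderiv ℝ f x v :=
    (hf.continuous_fderiv one_ne_zero).clm_apply continuous_const
  have hcs : HasCompactSupport fun x => fderiv ℝ f x v := hfc.fderiv_apply (𝕜 := ℝ) v
  have hint : Integrable (U.indicator fun x => fderiv ℝ f x v) volume :=
    (hcont.integrable_of_hasCompactSupport hcs).indicator hU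
  have hemb : MeasurableEmbedding e := e.toHomeomorph.measurableEmbedding
  rw [← integral_indicator hU, ← hmp.integral_comp hemb, Measure.volume_eq_prod,
    integral_prod (fun p => U.indicator (fun x => fderiv ℝ f x v) (e p))
      ((hmp.integrable_comp_emb hemb).2 hint), ← integral_indicator hB.measurableSet]
  refine integral_congr_ae (Eventually.of_forall fun y => ?_)
  dsimp only
  by_cases hy : y ∈ B
  · rw [Set.indicator_of_mem hy]
    have hgy := hg y hy
    -- On this vertical line `U` is `t ≤ g y` wherever `f` lives, so the fundamental theorem of
    -- calculus on `[l, g y]` leaves only the upper endpoint: `f` vanishes at height `l`.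
    have : ∀ t, U.indicator (fun x => fderiv ℝ f x v) (e (y, t)) =
        (Set.Ioc l (g y)).indicator (fun t => fderiv ℝ f (e (y, t)) v) t := by
      intro t
      by_cases ht : t ∈ Set.Ioo l r
      · by_cases htg : t ≤ g y
        · rw [Set.indicator_of_mem ((hUg y hy t (Set.Ioo_subset_Icc_self ht)).2 htg),
            Set.indicator_of_mem (show t ∈ Set.Ioc l (g y) from ⟨ht.1, htg⟩)]
        · rw [Set.indicator_of_notMem (fun h => htg ((hUg y hy t (Set.Ioo_subset_Icc_self ht)).1 h)),
            Set.indicator_of_notMem (fun h => htg h.2)]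
      · have h0 := hd0 y t (fun h => ht h.2)
        rw [Set.indicator_apply, Set.indicator_apply, h0]
        simp
    simp_rw [this]
    rw [integral_indicator measurableSet_Ioc, ← intervalIntegral.integral_of_le hgy.1.le,
      intervalIntegral.integral_eq_sub_of_hasDerivAt (fun t _ => hd y t), hf0 y l (by simp), sub_zero]
    refine Continuous.intervalIntegrable ?_ _ _
    exact hcont.comp (e.continuous.comp (by fun_prop))
  · rw [Set.indicator_of_notMem hy]
    refine integral_eq_zero_of_ae (Eventually.of_forall fun t => ?_)
    have h0 := hd0 y t (fun h => hy h.1)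
    dsimp only
    rw [Set.indicator_apply, h0]
    simp

/-- The Gauss–Green formula near a regular boundary point, in directions transversal to the
boundary. -/
theorem IsOutwardUnitNormal.exists_nhds_gaussGreen_of_inner_pos {U : Set Space3}
    (hU : MeasurableSet U) (hfin : Measure.euclideanHausdorffMeasure 2 (frontier U) < ⊤)
    {x₀ n v : Space3} (hn : IsOutwardUnitNormal U x₀ n) (hv : ‖v‖ = 1) (hvn : 0 < inner ℝ n v) :
    ∃ W ∈ 𝓝 x₀, ∀ f : Space3 → ℝ, ContDiff ℝ 1 f → HasCompactSupport f → tsupport f ⊆ W →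
      ∫ x in U, fderiv ℝ f x v = ∫ x, f x * inner ℝ v (outwardNormal U x) ∂surfaceMeasure U := by
  obtain ⟨φ, hφ, hφ0, rfl⟩ := hn.exists_isDefiningFunctionAt
  obtain ⟨e, hev, he, hmp⟩ := exists_orthogonal_coordinates hv
  have hfd : ∀ p, ContDiffAt ℝ 1 φ (e p) → ∀ q,
      fderiv ℝ (φ ∘ e) p q = inner ℝ (∇ φ (e p)) (e q) := by
    intro p hp q
    rw [inner_gradient_eq_fderiv,
      ((hp.differentiableAt one_ne_zero).hasFDerivAt.comp p e.hasFDerivAt).fderiv]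
    rfl
  set u := e.symm x₀ with hu
  have heu : e u = x₀ := e.apply_symm_apply x₀
  have hψ : ContDiffAt ℝ 1 (φ ∘ e) u :=
    ContDiffAt.comp u (by rw [heu]; exact hφ.1) e.contDiff.contDiffAt
  have hpos : 0 < fderiv ℝ (φ ∘ e) u (0, 1) := by
    rw [hfd u (by rw [heu]; exact hφ.1), heu, hev]
    rw [inner_smul_left] at hvn
    exact (pos_iff_pos_of_mul_pos hvn).1 (inv_pos.2 (norm_pos_iff.2 hφ.2.1))
  have hN : {p | IsDefiningFunctionAt U φ (e p)} ∈ 𝓝 u := by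
    refine e.continuous.continuousAt.eventually ?_
    rw [heu]
    exact hφ.eventually
  obtain ⟨a, b, g, ha, hb, hbox, hgr⟩ :=
    exists_subgraph_box hψ (by rw [Function.comp_apply, heu, hφ0]) hpos hN
  set B := Metric.ball u.1 b with hBdef
  set W := e '' (B ×ˢ Set.Ioo (u.2 - a) (u.2 + a)) with hW
  have hBo : IsOpen B := Metric.isOpen_ball
  have hWo : IsOpen W := e.toHomeomorph.isOpenMap _ (hBo.prod isOpen_Ioo)
  have hdef : ∀ y ∈ B, ∀ t ∈ Set.Icc (u.2 - a) (u.2 + a), IsDefiningFunctionAt U φ (e (y, t)) :=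
    fun y hy t ht => hbox (Set.mk_mem_prod hy ht)
  set Γ : Plane → Space3 := fun y => e (y, g y) with hΓ
  have hΓW : Γ '' B = frontier U ∩ W := by
    ext x
    constructor
    · rintro ⟨y, hy, rfl⟩
      have hgI := (hgr y hy).1
      have hgI' := Set.Ioo_subset_Icc_self hgI
      refine ⟨?_, _, Set.mk_mem_prod hy hgI, rfl⟩
      rw [(hdef y hy _ hgI').mem_frontier_iff]
      exact ((hgr y hy).2.2.1 _ hgI').2 rfl
    · rintro ⟨hxf, ⟨y, t⟩, ⟨hy, ht⟩, rfl⟩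
      have ht' := Set.Ioo_subset_Icc_self ht
      rw [(hdef y hy _ ht').mem_frontier_iff] at hxf
      refine ⟨y, hy, ?_⟩
      rw [hΓ, ((hgr y hy).2.2.1 t ht').1 hxf]
  refine ⟨W, hWo.mem_nhds ⟨u, ⟨Metric.mem_ball_self hb, by simp [ha], by simp [ha]⟩, heu⟩, ?_⟩
  intro f hf hfc hfs
  have hΓreg : ∀ y ∈ B, IsOutwardUnitNormal U (Γ y) (‖∇ φ (Γ y)‖⁻¹ • ∇ φ (Γ y)) := fun y hy =>
    (hdef y hy _ (Set.Ioo_subset_Icc_self (hgr y hy).1)).isOutwardUnitNormal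
      (hΓW.subset ⟨y, hy, rfl⟩).1
  set ℓ : Plane → Plane →L[ℝ] ℝ := fun y => -(fderiv ℝ (φ ∘ e) (y, g y) (0, 1))⁻¹ •
    (fderiv ℝ (φ ∘ e) (y, g y)).comp (ContinuousLinearMap.inl ℝ Plane ℝ) with hℓ
  have harea := setIntegral_image_eq_setIntegral_areaFactor (Γ := Γ) (B := B)
    (L := fun y => (e : (Plane × ℝ) →L[ℝ] Space3).comp
      ((ContinuousLinearMap.id ℝ Plane).prod (ℓ y))) (ℓ := fun y => (ℓ y).toLinearMap)
    (F := fun x => f x * inner ℝ v (outwardNormal U x)) (π := fun x => (e.symm x).1)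
    hBo (by fun_prop) (fun y _ => by simp [hΓ])
    (fun y hy => e.hasStrictFDerivAt.comp y
      ((hasStrictFDerivAt_id y).prodMk (hgr y hy).2.2.2.2))
    (fun y _ k k' => by
      change inner ℝ (e (k, ℓ y k)) (e (k', ℓ y k')) = _
      rw [he]; rfl)
    ((measure_mono (hΓW.subset.trans Set.inter_subset_left)).trans_lt hfin)
    (hf.continuous.continuousOn.mul (continuousOn_const.inner
      ((continuousOn_outwardNormal U).mono (by
        rintro _ ⟨y, hy, rfl⟩
        exact ⟨(hΓW.subset ⟨y, hy, rfl⟩).1, _, hΓreg y hy⟩))))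
  have hbd : ∫ x, f x * inner ℝ v (outwardNormal U x) ∂surfaceMeasure U =
      ∫ x in Γ '' B, f x * inner ℝ v (outwardNormal U x) ∂Measure.euclideanHausdorffMeasure 2 := by
    -- Boundary points off the graph lie outside `W`, hence outside the support of `f`.
    refine setIntegral_eq_of_subset_of_forall_sdiff_eq_zero isClosed_frontier.measurableSet
      (hΓW.subset.trans Set.inter_subset_left) fun x hx => ?_
    have : x ∉ tsupport f := fun hxs => hx.2 (hΓW.superset ⟨hx.1, hfs hxs⟩)
    rw [image_eq_zero_of_notMem_tsupport this, zero_mul]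
  rw [hbd, harea, integral_fderiv_subgraph hU hev hmp hBo (fun y hy => (hgr y hy).1)
    (fun y hy t ht => (hdef y hy t ht).2.2.self_of_nhds.trans ((hgr y hy).2.1 t ht)) hf hfc hfs]
  refine setIntegral_congr_fun hBo.measurableSet fun y hy => ?_
  have hdy := hdef y hy _ (Set.Ioo_subset_Icc_self (hgr y hy).1)
  have key := areaFactor_mul_inner_normal he (G := ∇ φ (Γ y)) (hgr y hy).2.2.2.1
    (hfd _ hdy.1 _).symm (ℓ := (ℓ y).toLinearMap) (fun k => by
      rw [← hfd _ hdy.1]; rfl)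
  change f (Γ y) = _ * (f (Γ y) * _)
  rw [(hΓreg y hy).outwardNormal_eq, ← hev]
  rw [mul_left_comm, key, mul_one]

end LocalGaussGreen

/-! ### Gauss–Green away from the singular set -/

section GaussGreenAwayFromSingularities

open scoped ContDiff Manifold

/-- The Gauss–Green formula for the function `f` in the direction `w`. -/
def GaussGreen (U : Set Space3) (f : Space3 → ℝ) (w : Space3) : Prop :=
  ∫ x in U, fderiv ℝ f x w = ∫ x, f x * inner ℝ w (outwardNormal U x) ∂surfaceMeasure U

variable {U : Set Space3}

theorem IsRegularDomain.isFiniteMeasure (hU : IsRegularDomain U) :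
    IsFiniteMeasure (surfaceMeasure U) :=
  ⟨by rw [surfaceMeasure, Measure.restrict_apply_univ]; exact hU.area_lt_top⟩

theorem IsRegularDomain.isCompact_frontier (hU : IsRegularDomain U) : IsCompact (frontier U) :=
  hU.isCompact.of_isClosed_subset isClosed_frontier hU.isCompact.isClosed.frontier_subset

theorem ae_mem_frontier (U : Set Space3) : ∀ᵐ x ∂surfaceMeasure U, x ∈ frontier U :=
  ae_restrict_mem isClosed_frontier.measurableSet

theorem IsRegularDomain.ae_mem_regularBoundary (hU : IsRegularDomain U) :
    ∀ᵐ x ∂surfaceMeasure U, x ∈ regularBoundary U :=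
  (ae_mem_frontier U).and hU.ae_normal

theorem IsRegularDomain.aestronglyMeasurable_outwardNormal (hU : IsRegularDomain U) :
    AEStronglyMeasurable (outwardNormal U) (surfaceMeasure U) := by
  rw [← Measure.restrict_eq_self_of_ae_mem hU.ae_mem_regularBoundary]
  exact (continuousOn_outwardNormal U).aestronglyMeasurable (measurableSet_regularBoundary U)

theorem IsRegularDomain.integrable_mul_inner (hU : IsRegularDomain U) {f : Space3 → ℝ}
    (hf : Continuous f) (w : Space3) :
    Integrable (fun x => f x * inner ℝ w (outwardNormal U x)) (surfaceMeasure U) := by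
  have := hU.isFiniteMeasure
  obtain ⟨C, hC⟩ := hU.isCompact_frontier.exists_bound_of_continuousOn hf.continuousOn
  refine Integrable.of_bound (C := C * ‖w‖) (hf.aestronglyMeasurable.mul
    (aestronglyMeasurable_const.inner hU.aestronglyMeasurable_outwardNormal)) ?_
  filter_upwards [ae_mem_frontier U] with x hx
  rw [norm_mul]
  have h1 : ‖inner ℝ w (outwardNormal U x)‖ ≤ ‖w‖ :=
    (norm_inner_le_norm w _).trans (mul_le_of_le_one_right (norm_nonneg _)
      (norm_outwardNormal_le_one U x))
  exact mul_le_mul (hC x hx) h1 (norm_nonneg _) ((norm_nonneg _).trans (hC x hx))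

theorem IsRegularDomain.integrableOn_fderiv (hU : IsRegularDomain U) {f : Space3 → ℝ}
    (hf : ContDiff ℝ 1 f) (w : Space3) : IntegrableOn (fun x => fderiv ℝ f x w) U :=
  ((hf.continuous_fderiv one_ne_zero).clm_apply continuous_const).continuousOn.integrableOn_compact
    hU.isCompact

theorem GaussGreen.smul_dir {f : Space3 → ℝ} {w : Space3} (h : GaussGreen U f w) (c : ℝ) :
    GaussGreen U f (c • w) := by
  unfold GaussGreen at *
  simp_rw [map_smul, smul_eq_mul, integral_const_mul, h, ← integral_const_mul, real_inner_smul_left,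
    mul_left_comm c]

theorem GaussGreen.sub_dir (hU : IsRegularDomain U) {f : Space3 → ℝ} (hf : ContDiff ℝ 1 f)
    {v w : Space3} (hv : GaussGreen U f v) (hw : GaussGreen U f w) : GaussGreen U f (v - w) := by
  unfold GaussGreen at *
  simp_rw [map_sub, inner_sub_left, mul_sub]
  rw [integral_sub (hU.integrableOn_fderiv hf v) (hU.integrableOn_fderiv hf w),
    integral_sub (hU.integrable_mul_inner hf.continuous v)
      (hU.integrable_mul_inner hf.continuous w), hv, hw]

theorem GaussGreen.sum (hU : IsRegularDomain U) {ι : Type*} {s : Finset ι} {f : ι → Space3 → ℝ}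
    (hf : ∀ i ∈ s, ContDiff ℝ 1 (f i)) {w : Space3} (h : ∀ i ∈ s, GaussGreen U (f i) w) :
    GaussGreen U (fun x => ∑ i ∈ s, f i x) w := by
  unfold GaussGreen at *
  have h1 : ∀ x, fderiv ℝ (fun x => ∑ i ∈ s, f i x) x w = ∑ i ∈ s, fderiv ℝ (f i) x w := by
    intro x
    rw [fderiv_fun_sum fun i hi => (hf i hi).differentiable one_ne_zero x]
    simp
  simp_rw [h1, Finset.sum_mul]
  rw [integral_finsetSum s fun i hi => hU.integrableOn_fderiv (hf i hi) w,
    integral_finsetSum s fun i hi => hU.integrable_mul_inner (hf i hi).continuous w]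
  exact Finset.sum_congr rfl h

/-- Integration by parts against the constant function one. -/
theorem integral_fderiv_eq_zero {f : Space3 → ℝ} (hf : ContDiff ℝ 1 f) (hfc : HasCompactSupport f)
    (w : Space3) : ∫ x, fderiv ℝ f x w = 0 := by
  have h1 : Integrable (fun x => fderiv ℝ f x w) :=
    ((hf.continuous_fderiv one_ne_zero).clm_apply
      continuous_const).integrable_of_hasCompactSupport (hfc.fderiv_apply (𝕜 := ℝ) w)
  have h2 : Integrable f := hf.continuous.integrable_of_hasCompactSupport hfc
  have := integral_mul_fderiv_eq_neg_fderiv_mul_of_integrable (μ := (volume : Measure Space3))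
    (f := fun _ => (1 : ℝ)) (g := f) (v := w) (by simp) (by simpa using h1) (by simpa using h2)
    (fun x _ => differentiableAt_const _) (fun x _ => hf.differentiable one_ne_zero x)
  simpa using this

/-- The Gauss–Green formula holds locally at all points except for the irregular boundary
points. -/
theorem IsRegularDomain.exists_nhds_gaussGreen (hU : IsRegularDomain U) {x₀ : Space3}
    (hx₀ : x₀ ∉ frontier U \ regularBoundary U) (w : Space3) :
    ∃ W ∈ 𝓝 x₀, ∀ f : Space3 → ℝ, ContDiff ℝ 1 f → HasCompactSupport f → tsupport f ⊆ W →
      GaussGreen U f w := by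
  have hzero : ∀ f : Space3 → ℝ, (∀ x ∈ frontier U, f x = 0) →
      ∫ x, f x * inner ℝ w (outwardNormal U x) ∂surfaceMeasure U = 0 := by
    intro f hf
    refine integral_eq_zero_of_ae ?_
    filter_upwards [ae_mem_frontier U] with x hx
    simp [hf x hx]
  by_cases hxf : x₀ ∈ frontier U
  · obtain ⟨-, n, hn⟩ : x₀ ∈ regularBoundary U := by
      by_contra hcon
      exact hx₀ ⟨hxf, hcon⟩
    have hn1 := hn.norm_eq_one
    have hnn : inner ℝ n n = (1 : ℝ) := by rw [real_inner_self_eq_norm_sq, hn1, one_pow]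
    -- This `c` gives `⟨n, w + c n⟩ ≥ 1`, so `w = z - c n` is a combination of two directions with
    -- positive normal component.
    set c := ‖w‖ + 1 with hc
    set z := w + c • n with hz
    have hnz : 0 < inner ℝ n z := by
      rw [hz, inner_add_right, inner_smul_right, hnn]
      have := neg_le_of_abs_le (abs_real_inner_le_norm n w)
      rw [hn1] at this
      linarith
    have hz0 : 0 < ‖z‖ := by
      refine norm_pos_iff.2 fun h0 => ?_
      rw [h0, inner_zero_right] at hnz
      exact lt_irrefl _ hnz
    obtain ⟨W₁, hW₁, h₁⟩ := hn.exists_nhds_gaussGreen_of_inner_pos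
      hU.isCompact.isClosed.measurableSet hU.area_lt_top (v := ‖z‖⁻¹ • z)
      (by rw [norm_smul, norm_inv, norm_norm, inv_mul_cancel₀ hz0.ne'])
      (by rw [inner_smul_right]; positivity)
    obtain ⟨W₂, hW₂, h₂⟩ := hn.exists_nhds_gaussGreen_of_inner_pos
      hU.isCompact.isClosed.measurableSet hU.area_lt_top (v := n) hn1 (by rw [hnn]; exact one_pos)
    refine ⟨W₁ ∩ W₂, inter_mem hW₁ hW₂, fun f hf hfc hfs => ?_⟩
    have g1 : GaussGreen U f (‖z‖⁻¹ • z) := h₁ f hf hfc (hfs.trans Set.inter_subset_left)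
    have g2 : GaussGreen U f n := h₂ f hf hfc (hfs.trans Set.inter_subset_right)
    have hw : w = ‖z‖ • ‖z‖⁻¹ • z - c • n := by
      rw [smul_smul, mul_inv_cancel₀ hz0.ne', one_smul, hz, add_sub_cancel_right]
    rw [hw]
    exact (g1.smul_dir _).sub_dir hU hf (g2.smul_dir _)
  by_cases hxU : x₀ ∈ U
  · have hxi : x₀ ∈ interior U := by
      by_contra hcon
      exact hxf ⟨subset_closure hxU, hcon⟩
    refine ⟨interior U, isOpen_interior.mem_nhds hxi, fun f hf hfc hfs => ?_⟩
    have hf0 : ∀ x ∈ frontier U, f x = 0 := fun x hx =>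
      image_eq_zero_of_notMem_tsupport fun h => hx.2 (hfs h)
    rw [GaussGreen, hzero f hf0, setIntegral_eq_integral_of_forall_compl_eq_zero,
      integral_fderiv_eq_zero hf hfc]
    intro x hx
    rw [image_eq_zero_of_notMem_tsupport
      (fun h => hx (interior_subset (hfs (tsupport_fderiv_subset ℝ h))))]
    rfl
  · refine ⟨Uᶜ, hU.isCompact.isClosed.isOpen_compl.mem_nhds hxU, fun f hf hfc hfs => ?_⟩
    have hf0 : ∀ x ∈ frontier U, f x = 0 := fun x hx =>
      image_eq_zero_of_notMem_tsupport fun h =>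
        hfs h (hU.isCompact.isClosed.frontier_subset hx)
    rw [GaussGreen, hzero f hf0]
    refine setIntegral_eq_zero_of_forall_eq_zero fun x hx => ?_
    rw [image_eq_zero_of_notMem_tsupport (fun h => hfs (tsupport_fderiv_subset ℝ h) hx)]
    rfl

/-- The Gauss–Green formula for functions supported away from the irregular boundary points. -/
theorem IsRegularDomain.gaussGreen_of_disjoint (hU : IsRegularDomain U) {f : Space3 → ℝ}
    (hf : ContDiff ℝ 1 f) (hfc : HasCompactSupport f)
    (hdisj : Disjoint (tsupport f) (frontier U \ regularBoundary U)) (w : Space3) :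
    GaussGreen U f w := by
  have hloc : ∀ x : {x : Space3 // x ∉ frontier U \ regularBoundary U}, ∃ W : Set Space3,
      IsOpen W ∧ x.1 ∈ W ∧ ∀ f : Space3 → ℝ, ContDiff ℝ 1 f → HasCompactSupport f →
        tsupport f ⊆ W → GaussGreen U f w := by
    intro x
    obtain ⟨W, hW, h⟩ := hU.exists_nhds_gaussGreen x.2 w
    exact ⟨interior W, isOpen_interior, mem_interior_iff_mem_nhds.2 hW,
      fun f h1 h2 h3 => h f h1 h2 (h3.trans interior_subset)⟩
  choose W hWo hxW hWG using hloc
  -- The partition need only sum to one on the support of `f`, and by compactness only finitely many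
  -- members meet it.
  obtain ⟨ρ, hρ⟩ := SmoothPartitionOfUnity.exists_isSubordinate 𝓘(ℝ, Space3)
    (isClosed_tsupport f) W hWo (fun x hx => Set.mem_iUnion.2
      ⟨⟨x, fun h => Set.disjoint_left.1 hdisj hx h⟩, hxW _⟩)
  have hfin := ρ.locallyFinite.finite_nonempty_inter_compact hfc
  have hρC : ∀ i, ContDiff ℝ 1 (ρ i) := fun i =>
    ((ρ i).contMDiff.contDiff).of_le (by exact_mod_cast le_top)
  have hsum : f = fun x => ∑ i ∈ hfin.toFinset, ρ i x * f x := by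
    funext x
    by_cases hx : x ∈ tsupport f
    · rw [← Finset.sum_mul, ← finsum_eq_sum_of_support_subset, ρ.sum_eq_one hx, one_mul]
      intro i hi
      rw [Finset.mem_coe, Set.Finite.mem_toFinset]
      exact ⟨x, hi, hx⟩
    · simp [image_eq_zero_of_notMem_tsupport hx]
  rw [hsum]
  refine GaussGreen.sum hU (fun i _ => (hρC i).mul hf) fun i _ => ?_
  exact hWG i _ ((hρC i).mul hf) hfc.mul_left ((tsupport_mul_subset_left).trans (hρ i))

end GaussGreenAwayFromSingularities

/-! ### Cutoffs around a compact set of zero area -/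

section Cutoff

open scoped ENNReal

/-- A compact set of zero area is covered by finitely many small balls, with the sum of the squared
radii as small as desired. -/
theorem exists_finite_ball_cover_of_area_eq_zero {E V : Set Space3} (hE : IsCompact E)
    (hne : E.Nonempty) (h0 : Measure.euclideanHausdorffMeasure 2 E = 0) (hV : IsOpen V)
    (hEV : E ⊆ V) {ε : ℝ} (hε : 0 < ε) :
    ∃ (T : Finset ℕ) (c : ℕ → Space3) (r : ℕ → ℝ), (∀ n, 0 < r n) ∧
      E ⊆ ⋃ n ∈ T, Metric.ball (c n) (r n) ∧ (∀ n, Metric.closedBall (c n) (2 * r n) ⊆ V) ∧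
      ∑ n ∈ T, r n ^ 2 ≤ ε := by
  obtain ⟨e₀, he₀⟩ := hne
  obtain ⟨δ, hδ, hδV⟩ := hE.exists_cthickening_subset_open hV hEV
  have hH : Measure.hausdorffMeasure 2 E = 0 := by
    rw [Measure.euclideanHausdorffMeasure_def, Measure.smul_apply, ENNReal.smul_def, smul_eq_mul,
      mul_eq_zero] at h0
    refine h0.resolve_left ?_
    exact_mod_cast Measure.addHaarScalarFactor_volume_hausdorffMeasure_ne_zero 2
  have hδ8 : 0 < ENNReal.ofReal (δ / 8) := ENNReal.ofReal_pos.2 (by positivity)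
  have hε4 : 0 < ENNReal.ofReal (ε / 4) := ENNReal.ofReal_pos.2 (by positivity)
  rw [Measure.hausdorffMeasure_apply] at hH
  -- Zero Hausdorff measure gives covers at every scale with small sum of squared diameters.
  -- Diameters up to `δ / 8` keep the doubled balls within `δ` of `E`.
  have hlt := (le_iSup₂ (f := fun (r : ℝ≥0∞) (_ : 0 < r) =>
        ⨅ (t : ℕ → Set Space3) (_ : E ⊆ ⋃ n, t n) (_ : ∀ n, Metric.ediam (t n) ≤ r),
          ∑' n, ⨆ _ : (t n).Nonempty, Metric.ediam (t n) ^ (2 : ℝ)) _ hδ8).trans_lt (hH.trans_lt hε4)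
  simp only [iInf_lt_iff] at hlt
  obtain ⟨t, hEt, htd, htsum⟩ := hlt
  obtain ⟨ε', hε'0, s, hs, hsε⟩ := posSumOfEncodable (by positivity : 0 < ε / 4) ℕ
  -- The padding makes radii positive even for sets of diameter zero; its squares are summable to at
  -- most `ε / 4`, and `(a + b)² ≤ 2a² + 2b²` brings the total to `ε`.
  set ρ : ℕ → ℝ := fun n => Metric.diam (t n) + min (δ / 8) √(ε' n) with hρ
  have htb : ∀ n, Metric.ediam (t n) ≠ ⊤ := fun n => ((htd n).trans_lt ENNReal.ofReal_lt_top).ne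
  have htd' : ∀ n, Metric.diam (t n) ≤ δ / 8 := fun n =>
    ENNReal.toReal_le_of_le_ofReal (by positivity) (htd n)
  have hmin : ∀ n, 0 < min (δ / 8) √(ε' n) := fun n =>
    lt_min (by positivity) (Real.sqrt_pos.2 (hε'0 n))
  have hρ0 : ∀ n, 0 < ρ n := fun n => add_pos_of_nonneg_of_pos Metric.diam_nonneg (hmin n)
  have hc : ∀ n, ∃ c ∈ E, t n ∩ E ⊆ Metric.ball c (ρ n) := by
    intro n
    rcases (t n ∩ E).eq_empty_or_nonempty with h | ⟨c, hct, hcE⟩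
    · exact ⟨e₀, he₀, by simp [h]⟩
    · refine ⟨c, hcE, fun y hy => ?_⟩
      exact (Metric.dist_le_diam_of_mem' (htb n) hy.1 hct).trans_lt (lt_add_of_pos_right _ (hmin n))
  choose c hcE hcb using hc
  obtain ⟨T, hT⟩ := hE.elim_finite_subcover (fun n => Metric.ball (c n) (ρ n))
    (fun _ => Metric.isOpen_ball) (fun x hx => by
      obtain ⟨n, hn⟩ := Set.mem_iUnion.1 (hEt hx)
      exact Set.mem_iUnion.2 ⟨n, hcb n ⟨hn, hx⟩⟩)
  refine ⟨T, c, ρ, hρ0, hT, fun n => ?_, ?_⟩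
  · refine ((Metric.closedBall_subset_closedBall ?_).trans
      (Metric.closedBall_subset_cthickening (hcE n) δ)).trans hδV
    have := htd' n
    have := min_le_left (δ / 8) √(ε' n)
    simp only [hρ]
    linarith
  · have hsq : ∀ n, ρ n ^ 2 ≤ 2 * Metric.diam (t n) ^ 2 + 2 * ε' n := by
      intro n
      have h1 : min (δ / 8) √(ε' n) ^ 2 ≤ ε' n := by
        refine (pow_le_pow_left₀ (hmin n).le (min_le_right _ _) 2).trans_eq ?_
        exact Real.sq_sqrt (hε'0 n).le
      simp only [hρ]
      nlinarith [sq_nonneg (Metric.diam (t n) - min (δ / 8) √(ε' n))]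
    have hdiam : ∑ n ∈ T, Metric.diam (t n) ^ 2 ≤ ε / 4 := by
      have h1 : ENNReal.ofReal (∑ n ∈ T, Metric.diam (t n) ^ 2) ≤ ENNReal.ofReal (ε / 4) := by
        rw [ENNReal.ofReal_sum_of_nonneg fun _ _ => sq_nonneg _]
        refine (Finset.sum_le_sum fun n _ => ?_).trans ((ENNReal.sum_le_tsum T).trans htsum.le)
        rw [ENNReal.ofReal_pow Metric.diam_nonneg, Metric.diam, ENNReal.ofReal_toReal (htb n)]
        rcases (t n).eq_empty_or_nonempty with h | h
        · simp [h]
        · simp [h]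
      exact (ENNReal.ofReal_le_ofReal_iff (by positivity)).1 h1
    have hε's : ∑ n ∈ T, ε' n ≤ s := sum_le_hasSum T (fun n _ => (hε'0 n).le) hs
    calc ∑ n ∈ T, ρ n ^ 2 ≤ ∑ n ∈ T, (2 * Metric.diam (t n) ^ 2 + 2 * ε' n) :=
          Finset.sum_le_sum fun n _ => hsq n
      _ = 2 * ∑ n ∈ T, Metric.diam (t n) ^ 2 + 2 * ∑ n ∈ T, ε' n := by
          rw [Finset.sum_add_distrib, Finset.mul_sum, Finset.mul_sum]
      _ ≤ ε := by linarith

/-- Smooth bumps at scale `r` whose gradient has integral proportional to `r ^ 2`. -/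
theorem exists_bump_integral_norm_fderiv :
    ∃ C : ℝ, 0 ≤ C ∧ ∀ (c : Space3) (r : ℝ), 0 < r → ∃ ψ : Space3 → ℝ, ContDiff ℝ 1 ψ ∧
      HasCompactSupport ψ ∧ (∀ x, ψ x ∈ Set.Icc (0 : ℝ) 1) ∧ (∀ x ∈ Metric.ball c r, ψ x = 1) ∧
      (∀ x ∉ Metric.closedBall c (2 * r), ψ x = 0) ∧ ∫ x, ‖fderiv ℝ ψ x‖ = C * r ^ 2 := by
  let b : ContDiffBump (0 : Space3) := ⟨1, 2, one_pos, one_lt_two⟩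
  refine ⟨∫ x, ‖fderiv ℝ b x‖, integral_nonneg fun _ => norm_nonneg _, fun c r hr => ?_⟩
  have hb : ContDiff ℝ 1 b := b.contDiff
  have hn : ∀ x : Space3, ‖r⁻¹ • (x - c)‖ = dist x c / r := fun x => by
    rw [norm_smul, norm_inv, Real.norm_of_nonneg hr.le, dist_eq_norm, div_eq_inv_mul]
  have hout : ∀ x ∉ Metric.closedBall c (2 * r), b (r⁻¹ • (x - c)) = 0 := fun x hx => by
    refine b.zero_of_le_dist ?_
    rw [dist_zero_right, hn, le_div_iff₀ hr]
    exact (not_le.1 hx).le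
  refine ⟨fun x => b (r⁻¹ • (x - c)), hb.comp (by fun_prop),
    HasCompactSupport.intro (isCompact_closedBall c (2 * r)) hout,
    fun x => ⟨b.nonneg, b.le_one⟩, fun x hx => b.one_of_mem_closedBall ?_, hout, ?_⟩
  · rw [mem_closedBall_zero_iff, hn, div_le_iff₀ hr]
    change _ ≤ 1 * r
    rw [one_mul]
    exact (Metric.mem_ball.1 hx).le
  · have hd : ∀ x, fderiv ℝ (fun x => b (r⁻¹ • (x - c))) x = r⁻¹ • fderiv ℝ b (r⁻¹ • (x - c)) := by
      intro x
      have h1 : HasFDerivAt (fun x : Space3 => r⁻¹ • (x - c))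
          (r⁻¹ • ContinuousLinearMap.id ℝ Space3) x :=
        ((hasFDerivAt_id x).sub_const c).const_smul r⁻¹
      have h2 := ((hb.differentiable one_ne_zero) (r⁻¹ • (x - c))).hasFDerivAt.comp x h1
      rw [show (fun x => b (r⁻¹ • (x - c))) = b ∘ fun x => r⁻¹ • (x - c) from rfl, h2.fderiv]
      refine ContinuousLinearMap.ext fun k => ?_
      simp
    -- The gradient contributes `r⁻¹` and the change of variables `r³`.
    simp_rw [hd, norm_smul, norm_inv, Real.norm_of_nonneg hr.le]
    rw [integral_const_mul, integral_sub_right_eq_self (fun x => ‖fderiv ℝ b (r⁻¹ • x)‖) c,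
      Measure.integral_comp_inv_smul volume (fun x => ‖fderiv ℝ b x‖) r]
    simp only [finrank_euclideanSpace, Fintype.card_fin, smul_eq_mul]
    rw [abs_of_pos (by positivity)]
    field_simp

/-- The norm of the derivative of a product of functions with values in `[0, 1]`. -/
theorem norm_fderiv_prod_le {ι : Type*} (s : Finset ι) {h : ι → Space3 → ℝ}
    (hd : ∀ i, Differentiable ℝ (h i)) (h01 : ∀ i x, h i x ∈ Set.Icc (0 : ℝ) 1) (x : Space3) :
    ‖fderiv ℝ (fun x => ∏ i ∈ s, h i x) x‖ ≤ ∑ i ∈ s, ‖fderiv ℝ (h i) x‖ := by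
  classical
  rw [fderiv_finsetProd fun i _ => hd i x]
  refine (norm_sum_le _ _).trans (Finset.sum_le_sum fun i _ => ?_)
  rw [norm_smul]
  refine mul_le_of_le_one_left (norm_nonneg _) ?_
  rw [norm_prod]
  refine Finset.prod_le_one (fun _ _ => norm_nonneg _) fun j _ => ?_
  rw [Real.norm_of_nonneg (h01 j x).1]
  exact (h01 j x).2

/-- Cutoff functions vanishing near a compact set of zero area, with small gradient in `L¹`. -/
theorem exists_cutoff_of_area_eq_zero {E V : Set Space3} (hE : IsCompact E)
    (h0 : Measure.euclideanHausdorffMeasure 2 E = 0) (hV : IsOpen V) (hEV : E ⊆ V) {ε : ℝ}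
    (hε : 0 < ε) :
    ∃ η : Space3 → ℝ, ContDiff ℝ 1 η ∧ (∀ x, η x ∈ Set.Icc (0 : ℝ) 1) ∧
      Disjoint (tsupport η) E ∧ (∀ x ∉ V, η x = 1) ∧
      Integrable (fun x => ‖fderiv ℝ η x‖) ∧ ∫ x, ‖fderiv ℝ η x‖ ≤ ε := by
  rcases E.eq_empty_or_nonempty with rfl | hne
  · exact ⟨fun _ => 1, contDiff_const, fun _ => by simp, by simp, fun _ _ => rfl, by simp,
      by simpa using hε.le⟩
  obtain ⟨C, hC, hbump⟩ := exists_bump_integral_norm_fderiv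
  -- Dividing by `C + 1` rather than `C` allows `C = 0`. The cutoff is the product of the `1 - ψ n`
  -- over the cover.
  obtain ⟨T, c, r, hr, hcov, hsub, hsum⟩ :=
    exists_finite_ball_cover_of_area_eq_zero hE hne h0 hV hEV (div_pos hε (by linarith : 0 < C + 1))
  choose ψ hψC hψc hψ01 hψ1 hψ0 hψi using fun n => hbump (c n) (r n) (hr n)
  have hC1 : ∀ n, ContDiff ℝ 1 fun x => 1 - ψ n x := fun n => contDiff_const.sub (hψC n)
  have h01 : ∀ n x, 1 - ψ n x ∈ Set.Icc (0 : ℝ) 1 := fun n x =>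
    ⟨by linarith [(hψ01 n x).2], by linarith [(hψ01 n x).1]⟩
  have hηC : ContDiff ℝ 1 fun x => ∏ n ∈ T, (1 - ψ n x) := contDiff_prod fun n _ => hC1 n
  have hint : ∀ n, Integrable fun x => ‖fderiv ℝ (ψ n) x‖ := fun n =>
    (((hψC n).continuous_fderiv one_ne_zero).integrable_of_hasCompactSupport
      ((hψc n).fderiv (𝕜 := ℝ))).norm
  have hbd : ∀ x, ‖fderiv ℝ (fun x => ∏ n ∈ T, (1 - ψ n x)) x‖ ≤
      ∑ n ∈ T, ‖fderiv ℝ (ψ n) x‖ := fun x => by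
    refine (norm_fderiv_prod_le T (fun n => (hC1 n).differentiable one_ne_zero) h01 x).trans_eq ?_
    refine Finset.sum_congr rfl fun n _ => ?_
    rw [fderiv_const_sub, norm_neg]
  have hsumint : Integrable fun x => ∑ n ∈ T, ‖fderiv ℝ (ψ n) x‖ :=
    integrable_finsetSum _ fun n _ => hint n
  have hηint : Integrable fun x => ‖fderiv ℝ (fun x => ∏ n ∈ T, (1 - ψ n x)) x‖ :=
    hsumint.mono' (hηC.continuous_fderiv one_ne_zero).norm.aestronglyMeasurable
      (Eventually.of_forall fun x => by rw [norm_norm]; exact hbd x)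
  refine ⟨fun x => ∏ n ∈ T, (1 - ψ n x), hηC, fun x =>
    ⟨Finset.prod_nonneg fun n _ => (h01 n x).1, Finset.prod_le_one (fun n _ => (h01 n x).1)
      fun n _ => (h01 n x).2⟩, ?_, fun x hx => ?_, hηint, ?_⟩
  · have hopen : IsOpen (⋃ n ∈ T, Metric.ball (c n) (r n)) :=
      isOpen_biUnion fun _ _ => Metric.isOpen_ball
    have hts : tsupport (fun x => ∏ n ∈ T, (1 - ψ n x)) ⊆ (⋃ n ∈ T, Metric.ball (c n) (r n))ᶜ := by
      refine closure_minimal (fun x hx hxb => hx ?_) hopen.isClosed_compl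
      simp only [Set.mem_iUnion] at hxb
      obtain ⟨n, hnT, hn⟩ := hxb
      exact Finset.prod_eq_zero hnT (by rw [hψ1 n x hn, sub_self])
    exact Set.disjoint_left.2 fun x hx hxE => hts hx (hcov hxE)
  · refine Finset.prod_eq_one fun n _ => ?_
    rw [hψ0 n x fun h => hx (hsub n h), sub_zero]
  · calc ∫ x, ‖fderiv ℝ (fun x => ∏ n ∈ T, (1 - ψ n x)) x‖
        ≤ ∫ x, ∑ n ∈ T, ‖fderiv ℝ (ψ n) x‖ := integral_mono hηint hsumint hbd
      _ = C * ∑ n ∈ T, r n ^ 2 := by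
          rw [integral_finsetSum _ fun n _ => hint n, Finset.mul_sum]
          exact Finset.sum_congr rfl fun n _ => hψi n
      _ ≤ C * (ε / (C + 1)) := mul_le_mul_of_nonneg_left hsum hC
      _ ≤ ε := by
          rw [mul_div_assoc', div_le_iff₀ (by linarith)]
          nlinarith

end Cutoff

/-! ### Gauss–Green on regular domains -/

section GaussGreenRegularDomain

variable {U : Set Space3}

theorem IsRegularDomain.area_irregular_eq_zero (hU : IsRegularDomain U) :
    Measure.euclideanHausdorffMeasure 2 (frontier U \ regularBoundary U) = 0 := by
  have h := hU.ae_mem_regularBoundary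
  rw [ae_iff, surfaceMeasure, Measure.restrict_apply'
    isClosed_frontier.measurableSet] at h
  refine measure_mono_null (fun x hx => ?_) h
  exact ⟨hx.2, hx.1⟩

/-- The Gauss–Green formula on regular domains for compactly supported `C¹` functions. -/
theorem IsRegularDomain.gaussGreen_of_hasCompactSupport (hU : IsRegularDomain U)
    {f : Space3 → ℝ} (hf : ContDiff ℝ 1 f) (hfc : HasCompactSupport f) (w : Space3) :
    GaussGreen U f w := by
  have := hU.isFiniteMeasure
  set E := frontier U \ regularBoundary U with hE
  have hEc : IsCompact E := hU.isCompact_frontier.of_isClosed_subset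
    (isClosed_frontier_diff_regularBoundary U) Set.sdiff_subset
  have hE2 := hU.area_irregular_eq_zero
  -- Finite two-dimensional measure forces the three-dimensional measure to vanish.
  have hE3 : volume E = 0 := by
    rw [← EuclideanSpace.euclideanHausdorffMeasure_eq_volume 3]
    refine (Measure.euclideanHausdorffMeasure_zero_or_top (by norm_num : 2 < 3) E).resolve_right ?_
    rw [hE2]
    exact ENNReal.zero_ne_top
  have hES : surfaceMeasure U E = 0 := Measure.absolutelyContinuous_of_le Measure.restrict_le_self hE2
  obtain ⟨M₁, hM₁⟩ := hf.continuous.bounded_above_of_compact_support hfc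
  obtain ⟨M₂, hM₂⟩ := (hf.continuous_fderiv one_ne_zero).bounded_above_of_compact_support
    (hfc.fderiv (𝕜 := ℝ))
  set M := max M₁ M₂ with hM
  have hM0 : 0 ≤ M := (norm_nonneg _).trans ((hM₁ 0).trans (le_max_left _ _))
  -- The three errors are the volume of `V`, the surface area in `V`, and the `L¹` norm of the
  -- gradient of `η`, each at most `ε`.
  have key : ∀ ε > 0, |(∫ x in U, fderiv ℝ f x w) -
      ∫ x, f x * inner ℝ w (outwardNormal U x) ∂surfaceMeasure U| ≤ M * ‖w‖ * (3 * ε) := by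
    intro ε hε
    obtain ⟨V₁, hEV₁, hV₁, hvol⟩ := E.exists_isOpen_lt_of_lt (μ := volume) (ENNReal.ofReal ε)
      (by rw [hE3]; exact ENNReal.ofReal_pos.2 hε)
    obtain ⟨V₂, hEV₂, hV₂, harea⟩ := E.exists_isOpen_lt_of_lt (μ := surfaceMeasure U)
      (ENNReal.ofReal ε) (by rw [hES]; exact ENNReal.ofReal_pos.2 hε)
    set V := V₁ ∩ V₂ with hV
    have hVo : IsOpen V := hV₁.inter hV₂
    obtain ⟨η, hηC, hη01, hηE, hηV, hηi, hηε⟩ := exists_cutoff_of_area_eq_zero hEc hE2 hVo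
      (Set.subset_inter hEV₁ hEV₂) hε
    have hgC : ContDiff ℝ 1 fun x => η x * f x := hηC.mul hf
    have hg : GaussGreen U (fun x => η x * f x) w :=
      hU.gaussGreen_of_disjoint hgC hfc.mul_left
        (hηE.mono_left tsupport_mul_subset_left) w
    have hone : ∀ x, |1 - η x| ≤ V.indicator 1 x := by
      intro x
      by_cases hx : x ∈ V
      · rw [Set.indicator_of_mem hx, abs_le]
        have := hη01 x
        constructor <;> simp <;> linarith [this.1, this.2]
      · rw [hηV x hx, Set.indicator_of_notMem hx]; simp
    have hvolV : (volume.restrict U).real V ≤ ε :=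
      ENNReal.toReal_le_of_le_ofReal hε.le ((Measure.restrict_apply_le _ _).trans
        ((measure_mono Set.inter_subset_left).trans hvol.le))
    have hareaV : (surfaceMeasure U).real V ≤ ε :=
      ENNReal.toReal_le_of_le_ofReal hε.le ((measure_mono Set.inter_subset_right).trans harea.le)
    have : IsFiniteMeasure (volume.restrict U : Measure Space3) :=
      ⟨by rw [Measure.restrict_apply_univ]; exact hU.isCompact.measure_lt_top⟩
    have hind : ∀ μ : Measure Space3, IsFiniteMeasure μ →
        Integrable (V.indicator (1 : Space3 → ℝ)) μ := fun μ _ =>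
      (integrable_const (1 : ℝ)).indicator hVo.measurableSet
    have h1 : |(∫ x in U, fderiv ℝ f x w) - ∫ x in U, fderiv ℝ (fun x => η x * f x) x w| ≤
        M * ‖w‖ * (2 * ε) := by
      rw [← integral_sub (hU.integrableOn_fderiv hf w) (hU.integrableOn_fderiv hgC w),
        ← Real.norm_eq_abs]
      have hint : Integrable (fun x => M * ‖w‖ * (V.indicator 1 x + ‖fderiv ℝ η x‖))
          (volume.restrict U) :=
        ((hind _ inferInstance).add hηi.integrableOn).const_mul _
      refine (norm_integral_le_of_norm_le hint (Eventually.of_forall fun x => ?_)).trans ?_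
      · have hd : fderiv ℝ (fun x => η x * f x) x w =
            η x * fderiv ℝ f x w + f x * fderiv ℝ η x w := by
          rw [fderiv_fun_mul (hηC.differentiable one_ne_zero x) (hf.differentiable one_ne_zero x)]
          rfl
        have e1 : ‖fderiv ℝ f x w‖ ≤ M * ‖w‖ :=
          (ContinuousLinearMap.le_opNorm _ _).trans (mul_le_mul_of_nonneg_right
            ((hM₂ x).trans (le_max_right _ _)) (norm_nonneg _))
        have e2 : ‖fderiv ℝ η x w‖ ≤ ‖fderiv ℝ η x‖ * ‖w‖ := ContinuousLinearMap.le_opNorm _ _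
        have e3 : ‖f x‖ ≤ M := (hM₁ x).trans (le_max_left _ _)
        rw [hd, show fderiv ℝ f x w - (η x * fderiv ℝ f x w + f x * fderiv ℝ η x w) =
          (1 - η x) * fderiv ℝ f x w - f x * fderiv ℝ η x w by ring]
        calc _ ≤ ‖1 - η x‖ * ‖fderiv ℝ f x w‖ + ‖f x‖ * ‖fderiv ℝ η x w‖ := by
              rw [← norm_mul, ← norm_mul]; exact norm_sub_le _ _
          _ ≤ V.indicator 1 x * (M * ‖w‖) + M * (‖fderiv ℝ η x‖ * ‖w‖) := by
              refine add_le_add (mul_le_mul (hone x) e1 (norm_nonneg _)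
                ((abs_nonneg _).trans (hone x))) (mul_le_mul e3 e2 (norm_nonneg _) hM0)
          _ = _ := by ring
      · rw [integral_const_mul, integral_add (hind _ inferInstance) hηi.integrableOn,
          integral_indicator_one hVo.measurableSet]
        refine mul_le_mul_of_nonneg_left ?_ (by positivity)
        have : ∫ x in U, ‖fderiv ℝ η x‖ ≤ ∫ x, ‖fderiv ℝ η x‖ :=
          setIntegral_le_integral hηi (Eventually.of_forall fun _ => norm_nonneg _)
        linarith
    have h2 : |(∫ x, f x * inner ℝ w (outwardNormal U x) ∂surfaceMeasure U) -
        ∫ x, η x * f x * inner ℝ w (outwardNormal U x) ∂surfaceMeasure U| ≤ M * ‖w‖ * ε := by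
      rw [← integral_sub (hU.integrable_mul_inner hf.continuous w)
        (hU.integrable_mul_inner hgC.continuous w), ← Real.norm_eq_abs]
      refine (norm_integral_le_of_norm_le ((hind _ inferInstance).const_mul (M * ‖w‖))
        (Eventually.of_forall fun x => ?_)).trans ?_
      · rw [show f x * inner ℝ w (outwardNormal U x) - η x * f x * inner ℝ w (outwardNormal U x) =
          f x * inner ℝ w (outwardNormal U x) * (1 - η x) by ring, norm_mul, norm_mul]
        have e1 : ‖inner ℝ w (outwardNormal U x)‖ ≤ ‖w‖ :=
          (norm_inner_le_norm w _).trans (mul_le_of_le_one_right (norm_nonneg _)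
            (norm_outwardNormal_le_one U x))
        exact mul_le_mul (mul_le_mul ((hM₁ x).trans (le_max_left _ _)) e1 (norm_nonneg _) hM0)
          (hone x) (norm_nonneg _) (by positivity)
      · rw [integral_const_mul, integral_indicator_one hVo.measurableSet]
        exact mul_le_mul_of_nonneg_left hareaV (by positivity)
    rw [GaussGreen] at hg
    rw [hg] at h1
    rw [abs_le] at h1 h2 ⊢
    constructor <;> linarith [h1.1, h1.2, h2.1, h2.2]
  rw [GaussGreen, ← sub_eq_zero, ← abs_nonpos_iff]
  have ht : Tendsto (fun ε : ℝ => M * ‖w‖ * (3 * ε)) (𝓝[>] 0) (𝓝 (M * ‖w‖ * (3 * 0))) :=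
    ((continuous_const.mul (continuous_const.mul continuous_id)).tendsto 0).mono_left
      nhdsWithin_le_nhds
  rw [mul_zero, mul_zero] at ht
  exact ge_of_tendsto ht (by filter_upwards [self_mem_nhdsWithin] with ε hε using key ε hε)

/-- The Gauss–Green formula on regular domains. -/
theorem IsRegularDomain.gaussGreen (hU : IsRegularDomain U) {f : Space3 → ℝ}
    (hf : ContDiff ℝ 1 f) (w : Space3) : GaussGreen U f w := by
  obtain ⟨R, hR, hUR⟩ := hU.isCompact.isBounded.subset_ball_lt 0 (0 : Space3)
  -- As `χ` equals one near every point of `U`, neither side notices the truncation.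
  let χ : ContDiffBump (0 : Space3) := ⟨R, R + 1, hR, by linarith⟩
  have hχ : ∀ x ∈ U, (χ : Space3 → ℝ) =ᶠ[𝓝 x] 1 := fun x hx =>
    χ.eventuallyEq_one_of_mem_ball (hUR hx)
  have h : GaussGreen U (fun x => χ x * f x) w :=
    hU.gaussGreen_of_hasCompactSupport (χ.contDiff.mul hf) χ.hasCompactSupport.mul_right w
  rw [GaussGreen] at h ⊢
  convert h using 1
  · refine setIntegral_congr_fun hU.isCompact.isClosed.measurableSet fun x hx => ?_
    have : (fun x => χ x * f x) =ᶠ[𝓝 x] f := by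
      filter_upwards [hχ x hx] with y hy
      rw [hy, Pi.one_apply, one_mul]
    rw [this.fderiv_eq]
  · refine integral_congr_ae ?_
    filter_upwards [ae_mem_frontier U] with x hx
    rw [(hχ x (hU.isCompact.isClosed.frontier_subset hx)).eq_of_nhds, Pi.one_apply, one_mul]

theorem IsRegularDomain.integrable_coord_mul_normal (hU : IsRegularDomain U) (x₀ : Space3)
    (i j : Fin 3) :
    Integrable (fun x => (x - x₀) i * outwardNormal U x j) (surfaceMeasure U) := by
  have := hU.integrable_mul_inner (f := fun x => (x - x₀) i) (by fun_prop)
    (EuclideanSpace.single j 1)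
  simpa [EuclideanSpace.inner_single_left] using this

/-- Gauss–Green for a coordinate function, whose derivative along a different axis is zero. -/
theorem IsRegularDomain.integral_coord_mul_normal_eq_zero (hU : IsRegularDomain U) (x₀ : Space3)
    {i j : Fin 3} (hij : i ≠ j) :
    ∫ x, (x - x₀) i * outwardNormal U x j ∂surfaceMeasure U = 0 := by
  have hd : ∀ x, fderiv ℝ (fun x : Space3 => (x - x₀) i) x (EuclideanSpace.single j 1) = 0 := by
    intro x
    have h1 : HasFDerivAt (fun x : Space3 => (x - x₀) i)
        (EuclideanSpace.proj i : Space3 →L[ℝ] ℝ) x := by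
      simpa using ((EuclideanSpace.proj i : Space3 →L[ℝ] ℝ).hasFDerivAt (x := x)).sub_const (x₀ i)
    rw [h1.fderiv]
    simp [hij]
  have := hU.gaussGreen (f := fun x => (x - x₀) i) (by fun_prop) (EuclideanSpace.single j 1)
  rw [GaussGreen] at this
  simp_rw [hd] at this
  simpa [EuclideanSpace.inner_single_left] using this.symm

end GaussGreenRegularDomain

/-! ### The moment of a constant pressure -/

theorem mainTheorem6 (U : Set Space3) (hU : IsRegularDomain U) (p : Space3 → ℝ)
    (hp : ∃ c : ℝ, ∀ x ∈ frontier U, p x = c) (x₀ : Space3) :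
    Integrable (momentDensity U p x₀) (surfaceMeasure U) ∧ pressureMoment U p x₀ = 0 := by
  obtain ⟨c, hc⟩ := hp
  let m : Fin 3 → Fin 3 → Space3 → ℝ := fun i j x =>
    (x - x₀) i * outwardNormal U x j - (x - x₀) j * outwardNormal U x i
  have hm : ∀ i j, Integrable (m i j) (surfaceMeasure U) := fun i j =>
    (hU.integrable_coord_mul_normal x₀ i j).sub (hU.integrable_coord_mul_normal x₀ j i)
  have hm0 : ∀ i j, i ≠ j → ∫ x, m i j x ∂surfaceMeasure U = 0 := fun i j hij => by
    rw [integral_sub (hU.integrable_coord_mul_normal x₀ i j)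
      (hU.integrable_coord_mul_normal x₀ j i), hU.integral_coord_mul_normal_eq_zero x₀ hij,
      hU.integral_coord_mul_normal_eq_zero x₀ hij.symm, sub_zero]
  -- Opaque names for `1`, `i`, `j`: the density becomes real functions times fixed vectors, and its
  -- integral reduces to three real integrals.
  obtain ⟨q₁, hq₁⟩ : ∃ q : ℍ[ℝ], q = ⟨1, 0, 0, 0⟩ := ⟨_, rfl⟩
  obtain ⟨q₂, hq₂⟩ : ∃ q : ℍ[ℝ], q = ⟨0, 1, 0, 0⟩ := ⟨_, rfl⟩
  obtain ⟨q₃, hq₃⟩ : ∃ q : ℍ[ℝ], q = ⟨0, 0, 1, 0⟩ := ⟨_, rfl⟩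
  have heq : momentDensity U p x₀ =ᵐ[surfaceMeasure U] fun x =>
      c • (m 1 2 x • q₁ + m 2 0 x • q₂ + m 0 1 x • q₃) := by
    filter_upwards [ae_mem_frontier U] with x hx
    rw [momentDensity, hc x hx]
    congr 1
    ext <;> simp [reducedCross, toReduced, m] <;> simp [hq₁, hq₂, hq₃]
  have h1 := (hm 1 2).smul_const q₁
  have h2 := (hm 2 0).smul_const q₂
  have h3 := (hm 0 1).smul_const q₃
  refine ⟨(((h1.add h2).add h3).smul c).congr heq.symm, ?_⟩
  rw [pressureMoment, integral_congr_ae heq, integral_smul,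
    integral_add (f := fun x => m 1 2 x • q₁ + m 2 0 x • q₂) (h1.add h2) h3,
    integral_add h1 h2, integral_smul_const, integral_smul_const, integral_smul_const,
    hm0 1 2 (by decide), hm0 2 0 (by decide), hm0 0 1 (by decide)]
  simp
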